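/- A word over the positive integers avoids $123$ (respectively $231$) if it has no subword (not necessarily contiguous) $abc$ with $a<b<c$ (respectively no subword $bca$ with $a<b<c$). Let $f_4(x)=\sum_{n\ge 0}w_4(n)x^n$, where $w_4(n)$ is the number of $123$-avoiding words of length $4n$ in which each of the letters $1,\dots,n$ occurs exactly $4$ times. Let $P(x,F)\in\mathbb Z[x][F]$ be the polynomial $$ \begin{aligned} P(x,F)={}&x^3(5x-256)^4(4x+1)^4F^{16}+4x^3(85x+58)(5x-256)^3(4x+1)^3F^{14}\\ &+2x^2(200x^4+11845x^3+8658x^2+6503x+256)(5x-256)^2(4x+1)^2F^{12}\\ &+4x^2(5x-256)(4x+1)(25500x^5-977800x^4+15739435x^3+9911721x^2+2082455x+138496)F^{10}\\ &+x(60000x^8+2772000x^7-471787725x^6+11351360680x^5+15348867846x^4\\ &\qquad+7091445146x^3+1387805641x^2+96468480x-458752)F^8\\ &+4x(127500x^7-6439500x^6+28100475x^5+187145995x^4+58215739x^3-5955159x^2-2743199x-108800)F^6\\ &+(10000x^8+628250x^7-57924600x^6+1098116930x^5+827342646x^4\\ &\qquad+223797652x^3+24970546x^2+842512x+1024)F^4\\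 &+(42500x^7-1521500x^6-6516800x^5-7480160x^4-276672x^3+461716x^2+49271x-1024)F^2\\ &+x(x+1)^2(25x^2+65x+11)^2 . \end{aligned} $$ Then: 1. $P$ has degree $16$ in $F$, with leading coefficient $x^3(5x-256)^4(4x+1)^4$, and $P(x,f_4(x))=0$ in $\mathbb Z[[x]]$. 2. This equation is minimal: $P$ is irreducible in $\mathbb Z[x][F]$; every nonzero $Q\in\mathbb Z[x][F]$ with $Q(x,f_4(x))=0$ has degree at least $16$ in $F$; and every $Q\in\mathbb Z[x][F]$ with $Q(x,f_4(x))=0$ is a multiple of $P$ in $\mathbb Z[x][F]$. 3. For $0\le i\le j\le 3$ let $g^{(i,j)}(x)=g^{(j,i)}(x)$ be the generating function, by length, of the $231$-avoiding words that, for some $n\ge0$, consist of $i$ letters $1$, $j$ letters $n+2$ and exactly $4$ copies of each of $2,\dots,n+1$. These ten series satisfy the ten equations, for $0\le i\le j\le 3$, $$g^{(i,j)}=\delta_{i,0}\delta_{j,0}+x\sum_{t=0}^{3}g^{(i,t)}\,g^{((4-t)\bmod 4,\;(j-1)\bmod 4)}+\sum_{m=0}^{i-1}x^{m+1}g^{(i-m,\,j-1)},$$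 and $g^{(0,0)}(x)=f_4(x^4)$. 4. $P$ is the result of eliminating all unknowns except $g^{(0,0)}$ from these ten equations, on the component of the solution set that contains the actual generating functions, and replacing $x^4$ by $x$. Precisely, let $I$ be the ideal generated by the ten equations in the polynomial ring over $\mathbb Z[x]$ in ten unknowns $g^{(i,j)}$. For $Q\in\mathbb Z[x][F]$, there is a polynomial $h$ in that ring, not vanishing at the actual generating functions, with $h\cdot Q(x,g^{(0,0)})\in I$, if and only if $P(x^4,F)$ divides $Q(x,F)$ in $\mathbb Z[x][F]$. -/

import Mathlib

open scoped Polynomial PowerSeries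

/-- The word `w` avoids the pattern `123`: no subword `w_i w_j w_k` (`i < j < k`) is strictly
increasing. -/
def Avoids123 (w : List ℕ) : Prop :=
  ∀ a b c : ℕ, [a, b, c].Sublist w → ¬ (a < b ∧ b < c)

/-- The word `w` avoids the pattern `231`: there is no subword `b c a` with `a < b < c`. -/
def Avoids231 (w : List ℕ) : Prop :=
  ∀ a b c : ℕ, [b, c, a].Sublist w → ¬ (a < b ∧ b < c)

/-- The `123`-avoiding words in which each of the letters `1, …, n` occurs exactly `r` times (and no
other letter occurs). -/
def words123 (r n : ℕ) : Set (List ℕ) :=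
  {w | Avoids123 w ∧ ∀ a, w.count a = if 1 ≤ a ∧ a ≤ n then r else 0}

/-- The ordinary generating function `∑ₙ #(words123 r n) xⁿ`. -/
noncomputable def genFun123 (r : ℕ) : ℤ⟦X⟧ :=
  PowerSeries.mk fun n => ((words123 r n).ncard : ℤ)

/-- The `231`-avoiding words in the alphabet `1, …, n + 2` with `i` occurrences of the letter `1`,
`j` occurrences of the letter `n + 2` and `r` occurrences of each of `2, …, n + 1`. -/
def words231 (r i j n : ℕ) : Set (List ℕ) :=
  {w | Avoids231 w ∧ ∀ a, w.count a =
    if a = 1 then i else if a = n + 2 then j else if 2 ≤ a ∧ a ≤ n + 1 then r else 0}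

/-- The enumerator, by length, of the union over all `n ≥ 0` of the sets `words231 r i j n`. -/
noncomputable def weightEnum (r i j : ℕ) : ℤ⟦X⟧ :=
  PowerSeries.mk fun N => ({w | (∃ n, w ∈ words231 r i j n) ∧ w.length = N}.ncard : ℤ)

/-- The family `g^{(i,j)}`, `0 ≤ i ≤ j ≤ r - 1`, with the convention `g^{(j,i)} = g^{(i,j)}`, as a
family indexed by unordered pairs. -/
noncomputable def weightEnumFamily (r : ℕ) (p : Sym2 (Fin r)) : ℤ⟦X⟧ :=
  weightEnum r p.inf p.sup

/-- The ring `ℤ[x][g^{(i,j)}]` with one unknown for each unordered pair of indices. -/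
abbrev SchemeRing (r : ℕ) : Type := MvPolynomial (Sym2 (Fin r)) ℤ[X]

/-- The `(i, j)`-th equation of the algebraic enumeration scheme, left side minus right side:
`g^{(i,j)} = δ_{i,0} δ_{j,0} + x ∑_{t=0}^{r-1} g^{(i,t)} g^{((r-t) mod r, (j-1) mod r)}
  + ∑_{m=0}^{i-1} x^{m+1} g^{(i-m, j-1)}`.
Arithmetic in `Fin r` is modulo `r`, so `-t` is `(r - t) mod r` and `j - 1` is `(j - 1) mod r`; in
the last sum `m < i`, so `i - m` does not wrap, and neither does `j - 1` when `0 < i ≤ j`. -/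
noncomputable def schemeEq (r : ℕ) [NeZero r] (i j : Fin r) : SchemeRing r :=
  MvPolynomial.X s(i, j) -
    ((if i = 0 ∧ j = 0 then 1 else 0)
      + MvPolynomial.C Polynomial.X *
          ∑ t : Fin r, MvPolynomial.X s(i, t) * MvPolynomial.X s(-t, j - 1)
      + ∑ m ∈ Finset.range (i : ℕ),
          MvPolynomial.C (Polynomial.X ^ (m + 1)) *
            MvPolynomial.X s(i - Fin.ofNat r m, j - 1))

/-- The ideal generated by the `r (r + 1) / 2` equations of the scheme. -/
noncomputable def schemeIdeal (r : ℕ) [NeZero r] : Ideal (SchemeRing r) :=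
  Ideal.span {q | ∃ i j : Fin r, i ≤ j ∧ q = schemeEq r i j}

open Polynomial in
/-- The coefficient of `F ^ (2 k)` in the equation `P(x, F) = 0`, a polynomial in `x = X`. -/
noncomputable def eqCoeff4 : ℕ → ℤ[X]
  | 8 => X ^ 3 * (5 * X - 256) ^ 4 * (4 * X + 1) ^ 4
  | 7 => 4 * X ^ 3 * (85 * X + 58) * (5 * X - 256) ^ 3 * (4 * X + 1) ^ 3
  | 6 => 2 * X ^ 2 * (200 * X ^ 4 + 11845 * X ^ 3 + 8658 * X ^ 2 + 6503 * X + 256)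
      * (5 * X - 256) ^ 2 * (4 * X + 1) ^ 2
  | 5 => 4 * X ^ 2 * (5 * X - 256) * (4 * X + 1)
      * (25500 * X ^ 5 - 977800 * X ^ 4 + 15739435 * X ^ 3 + 9911721 * X ^ 2 + 2082455 * X
        + 138496)
  | 4 => X * (60000 * X ^ 8 + 2772000 * X ^ 7 - 471787725 * X ^ 6 + 11351360680 * X ^ 5
        + 15348867846 * X ^ 4 + 7091445146 * X ^ 3 + 1387805641 * X ^ 2 + 96468480 * X
        - 458752)
  | 3 => 4 * X * (127500 * X ^ 7 - 6439500 * X ^ 6 + 28100475 * X ^ 5 + 187145995 * X ^ 4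
        + 58215739 * X ^ 3 - 5955159 * X ^ 2 - 2743199 * X - 108800)
  | 2 => 10000 * X ^ 8 + 628250 * X ^ 7 - 57924600 * X ^ 6 + 1098116930 * X ^ 5
        + 827342646 * X ^ 4 + 223797652 * X ^ 3 + 24970546 * X ^ 2 + 842512 * X + 1024
  | 1 => 42500 * X ^ 7 - 1521500 * X ^ 6 - 6516800 * X ^ 5 - 7480160 * X ^ 4 - 276672 * X ^ 3
        + 461716 * X ^ 2 + 49271 * X - 1024
  | 0 => X * (X + 1) ^ 2 * (25 * X ^ 2 + 65 * X + 11) ^ 2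
  | _ => 0

/-- The polynomial `P(x, F)`, as a polynomial in the variable `F` over `ℤ[x]`. -/
noncomputable def eqPoly4 : ℤ[X][X] :=
  ∑ k ∈ Finset.range 9, Polynomial.C (eqCoeff4 k) * Polynomial.X ^ (2 * k)

/-! Counting. Reversal turns 231 into 132, and 123 and 132 are both patterns in which the first
letter is smallest and the other two are in a prescribed order. A word avoiding either one is
determined by its content and its weak left-to-right minima with their positions, and the same
skeletons occur for both. So 123 and 231 are equidistributed on every multiset of letters. In a
231-avoider, every letter before the first largest letter is at most every letter after it. The cut
therefore splits the sorted content into an initial and a final segment, and each is again of the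
type counted by `count231`. This gives the quadratic scheme.

Elimination. With `y` marking the number of middle letters, the scheme is a 4 × 4 matrix Riccati
equation. It linearises to `V - V * V = W`, where `W` is the explicit `kernelMatrix y` and the
corner `V 3 0` is `y * f`. Thus `1 - 2V` is a square root of `1 - 4W`. The corner functional is
represented by the trace against an explicit polynomial `D` in `W`, so up to a scalar `f` is the
trace of `X = D(1 - 2V)`, whose square is explicit. Comparing the characteristic polynomials of `X`
and of its square gives an equation of degree 16, one conjugate for each choice of four signs.

Minimality. `P` is even in `F`. The underlying polynomial of degree 8 is irreducible by reduction
modulo 3 and 7, and substituting the square of `F` preserves irreducibility because the constant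
coefficient has odd degree in `x`. Gauss's lemma then makes `P` a divisor of every equation for `f`,
and separating exponents of `x` modulo 4 transfers this to `f(x^4)`.

Component. Modulo `x` the Jacobian of the ten equations is the identity. The local ring of the
scheme at the actual solution is therefore unramified over the rational functions in `x`, hence a
field, so locally the ideal contains every relation satisfied by the solution. -/

/-! ### Equidistribution of 123 and 132 through left-to-right minima. -/

/-- `w` has no subword `a b c` with `a` smaller than both `b` and `c`, and `R b c`. -/
def AvoidsMinFirst (R : ℕ → ℕ → Prop) (w : List ℕ) : Prop :=
  ∀ a b c : ℕ, [a, b, c].Sublist w → ¬ (a < b ∧ a < c ∧ R b c)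

/-- The weak left-to-right minima of `w` below the initial bound `m`, with their positions. -/
def minSkeleton : ℕ → List ℕ → List (Option ℕ)
  | _, [] => []
  | m, a :: w => if a ≤ m then some a :: minSkeleton a w else none :: minSkeleton m w

theorem AvoidsMinFirst.sublist {R : ℕ → ℕ → Prop} {w w' : List ℕ} (h : AvoidsMinFirst R w)
    (hw : w'.Sublist w) : AvoidsMinFirst R w' :=
  fun a b c habc => h a b c (habc.trans hw)

theorem avoidsMinFirst_cons {R : ℕ → ℕ → Prop} {a : ℕ} {w : List ℕ} :
    AvoidsMinFirst R (a :: w) ↔ AvoidsMinFirst R w ∧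
      ∀ b c, [b, c].Sublist w → ¬ (a < b ∧ a < c ∧ R b c) := by
  constructor
  · intro h
    exact ⟨h.sublist (List.sublist_cons_self _ _), fun b c hbc => h a b c (hbc.cons_cons a)⟩
  · rintro ⟨h1, h2⟩ x b c hs
    cases hs with
    | cons _ h => exact h1 x b c h
    | cons_cons _ h => exact h2 b c h

theorem not_rel_of_avoidsMinFirst {R : ℕ → ℕ → Prop} {m a b : ℕ} {u : List ℕ}
    (h : AvoidsMinFirst R (m :: a :: u)) (ha : m < a) (hb : m < b) (hbu : b ∈ a :: u)
    (hR : R a b) : a = b := by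
  rcases List.mem_cons.1 hbu with rfl | hbu
  · rfl
  · refine absurd ⟨ha, hb, hR⟩ (h m a b ?_)
    exact ((List.singleton_sublist.2 hbu).cons_cons a).cons_cons m

/-- At a position that is not a weak minimum, avoidance forces the letter to be `R`-maximal among
the remaining letters above the current minimum `m`. By trichotomy that letter is unique, so the
word can be read off its skeleton and content. -/
theorem minSkeleton_injOn (R : ℕ → ℕ → Prop) [Std.Trichotomous R] :
    ∀ (w w' : List ℕ) (m : ℕ), AvoidsMinFirst R (m :: w) → AvoidsMinFirst R (m :: w') →
      w.Perm w' → minSkeleton m w = minSkeleton m w' → w = w' := by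
  intro w
  induction w with
  | nil => intro w' m _ _ hp _; exact hp.nil_eq
  | cons a u ih =>
    intro w' m h h' hp hs
    cases w' with
    | nil => exact absurd hp.eq_nil (by simp)
    | cons a' u' =>
      by_cases ha : a ≤ m
      · by_cases ha' : a' ≤ m
        · simp only [minSkeleton, ha, ha', if_true, List.cons.injEq, Option.some.injEq] at hs
          obtain ⟨rfl, hs⟩ := hs
          rw [ih u' a (h.sublist (List.sublist_cons_self _ _))
            (h'.sublist (List.sublist_cons_self _ _)) ((List.perm_cons a).1 hp) hs]
        · simp [minSkeleton, ha, ha'] at hs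
      · by_cases ha' : a' ≤ m
        · simp [minSkeleton, ha, ha'] at hs
        · simp only [minSkeleton, ha, ha', if_false, List.cons.injEq, true_and] at hs
          have h1 : a' ∈ a :: u := hp.mem_iff.2 (by simp)
          have h2 : a ∈ a' :: u' := hp.mem_iff.1 (by simp)
          have haa : a = a' := by
            rcases Std.Trichotomous.rel_or_eq_or_rel_swap (r := R) (a := a) (b := a')
              with hr | hr | hr
            · exact not_rel_of_avoidsMinFirst h (not_le.1 ha) (not_le.1 ha') h1 hr
            · exact hr
            · exact (not_rel_of_avoidsMinFirst h' (not_le.1 ha') (not_le.1 ha) h2 hr).symm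
          subst haa
          rw [ih u' m (h.sublist ((List.sublist_cons_self _ _).cons_cons m))
            (h'.sublist ((List.sublist_cons_self _ _).cons_cons m)) ((List.perm_cons a).1 hp) hs]

theorem minSkeleton_replace {x y : ℕ} (u₂ : List ℕ) :
    ∀ (u₁ : List ℕ) (m : ℕ), m < x → m < y →
      minSkeleton m (u₁ ++ x :: u₂) = minSkeleton m (u₁ ++ y :: u₂) := by
  intro u₁
  induction u₁ with
  | nil => intro m hx hy; simp [minSkeleton, not_le.2 hx, not_le.2 hy]
  | cons a u ih =>
    intro m hx hy
    by_cases ha : a ≤ m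
    · simp [minSkeleton, ha, ih a (by omega) (by omega)]
    · simp [minSkeleton, ha, ih m hx hy]

theorem exists_rel_maximal (R : ℕ → ℕ → Prop) [IsStrictOrder ℕ R] (m : ℕ) :
    ∀ (u : List ℕ) (a : ℕ), m < a → ∃ b ∈ a :: u, m < b ∧ ∀ c ∈ a :: u, m < c → ¬ R b c := by
  intro u
  induction u with
  | nil =>
    intro a ha
    refine ⟨a, by simp, ha, ?_⟩
    simp only [List.mem_singleton]
    rintro c rfl _
    exact irrefl c
  | cons x u ih =>
    intro a ha
    obtain ⟨b, hb, hmb, hmax⟩ := ih a ha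
    by_cases hx : m < x ∧ R b x
    · refine ⟨x, by simp, hx.1, ?_⟩
      intro c hc hmc hxc
      rcases List.mem_cons.1 hc with rfl | hc
      · exact hmax c (by simp) hmc (_root_.trans hx.2 hxc)
      rcases List.mem_cons.1 hc with rfl | hc
      · exact irrefl c hxc
      · exact hmax c (by simp [hc]) hmc (_root_.trans hx.2 hxc)
    · refine ⟨b, ?_, hmb, ?_⟩
      · rcases List.mem_cons.1 hb with rfl | hb <;> simp [*]
      · intro c hc hmc
        rcases List.mem_cons.1 hc with rfl | hc
        · exact hmax c (by simp) hmc
        rcases List.mem_cons.1 hc with rfl | hc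
        · exact fun h => hx ⟨hmc, h⟩
        · exact hmax c (by simp [hc]) hmc

/-- Greedy construction: at each position that is not a weak minimum, swap in an `R`-maximal
remaining letter above `m`. Both swapped letters exceed `m`, so the skeleton is unchanged. -/
theorem exists_avoidsMinFirst (R : ℕ → ℕ → Prop) [IsStrictOrder ℕ R] :
    ∀ (k : ℕ) (w : List ℕ) (m : ℕ), w.length = k → ∃ w' : List ℕ, w'.Perm w ∧
      minSkeleton m w' = minSkeleton m w ∧ AvoidsMinFirst R (m :: w') := by
  intro k
  induction k with
  | zero =>
    intro w m hw
    obtain rfl := List.length_eq_zero_iff.1 hw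
    refine ⟨[], List.Perm.refl _, rfl, ?_⟩
    intro a b c h
    exact absurd h.length_le (by simp)
  | succ k ih =>
    intro w m hw
    cases w with
    | nil => simp at hw
    | cons a u =>
      have hu : u.length = k := by simpa using hw
      by_cases ha : a ≤ m
      · obtain ⟨u', hp, hs, hav⟩ := ih u a hu
        refine ⟨a :: u', hp.cons a, by simp [minSkeleton, ha, hs], ?_⟩
        rw [avoidsMinFirst_cons]
        refine ⟨hav, ?_⟩
        rintro b c hbc ⟨hb, hc, hR⟩
        cases hbc with
        | cons _ h => exact (avoidsMinFirst_cons.1 hav).2 b c h ⟨by omega, by omega, hR⟩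
        | cons_cons _ h => omega
      · push Not at ha
        obtain ⟨x, hx, hmx, hmax⟩ := exists_rel_maximal R m u a ha
        have key : ∃ v : List ℕ, v.length = k ∧ (x :: v).Perm (a :: u) ∧
            minSkeleton m v = minSkeleton m u := by
          rcases List.mem_cons.1 hx with rfl | hx
          · exact ⟨u, hu, List.Perm.refl _, rfl⟩
          · obtain ⟨u₁, u₂, rfl⟩ := List.append_of_mem hx
            refine ⟨u₁ ++ a :: u₂, by simpa using hu, ?_, minSkeleton_replace u₂ u₁ m ha hmx⟩
            calc (x :: (u₁ ++ a :: u₂)).Perm (x :: a :: (u₁ ++ u₂)) :=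
                  List.perm_middle.cons x
              _ |>.Perm (a :: x :: (u₁ ++ u₂)) := List.Perm.swap _ _ _
              _ |>.Perm (a :: (u₁ ++ x :: u₂)) := List.perm_middle.symm.cons a
        obtain ⟨v, hv, hxv, hsv⟩ := key
        obtain ⟨v', hp, hs, hav⟩ := ih v m hv
        refine ⟨x :: v', (hp.cons x).trans hxv, ?_, ?_⟩
        · simp [minSkeleton, not_le.2 hmx, not_le.2 ha, hs, hsv]
        · have hav' := avoidsMinFirst_cons.1 hav
          rw [avoidsMinFirst_cons, avoidsMinFirst_cons]
          refine ⟨⟨hav'.1, ?_⟩, ?_⟩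
          · rintro b c hbc ⟨hb, hc, hR⟩
            exact hav'.2 b c hbc ⟨by omega, by omega, hR⟩
          · rintro b c hbc ⟨hb, hc, hR⟩
            cases hbc with
            | cons _ h => exact hav'.2 b c h ⟨hb, hc, hR⟩
            | cons_cons _ h =>
              refine hmax c ?_ hc hR
              have : c ∈ x :: v' := List.mem_cons_of_mem _ (List.singleton_sublist.1 h)
              exact ((hp.cons x).trans hxv).mem_iff.1 this

/-! ### Words of given content and their symmetries. -/

/-- The words with letter multiset `M` that satisfy `p`. -/
def wordsWith (p : List ℕ → Prop) (M : Multiset ℕ) : Set (List ℕ) :=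
  {w | p w ∧ (w : Multiset ℕ) = M}

theorem finite_wordsWith (p : List ℕ → Prop) (M : Multiset ℕ) : (wordsWith p M).Finite := by
  induction M using Quotient.inductionOn with
  | _ l =>
    refine (List.finite_toSet l.permutations).subset ?_
    rintro w ⟨_, hw⟩
    exact List.mem_permutations.2 (Multiset.coe_eq_coe.1 hw)

/-- The right side does not mention `R`, which is the whole point. The bound `m` acts as a virtual
first letter, too large to start a forbidden pattern. -/
theorem ncard_wordsWith_avoidsMinFirst (R : ℕ → ℕ → Prop) [IsStrictTotalOrder ℕ R]
    (M : Multiset ℕ) {m : ℕ} (hm : ∀ a ∈ M, a ≤ m) :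
    (wordsWith (AvoidsMinFirst R) M).ncard =
      (minSkeleton m '' {w | (w : Multiset ℕ) = M}).ncard := by
  have hcons : ∀ w : List ℕ, (w : Multiset ℕ) = M → AvoidsMinFirst R w →
      AvoidsMinFirst R (m :: w) := by
    intro w hw h
    refine avoidsMinFirst_cons.2 ⟨h, ?_⟩
    rintro b c hbc ⟨hb, -, -⟩
    have : b ∈ M := by
      rw [← hw]; exact hbc.subset (by simp)
    exact absurd (hm b this) (by omega)
  rw [← Set.InjOn.ncard_image (f := minSkeleton m)]
  · congr 1
    ext s
    constructor
    · rintro ⟨w, ⟨_, hw⟩, rfl⟩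
      exact ⟨w, hw, rfl⟩
    · rintro ⟨w, hw, rfl⟩
      obtain ⟨w', hp, hs, hav⟩ := exists_avoidsMinFirst R _ w m rfl
      refine ⟨w', ⟨hav.sublist (List.sublist_cons_self _ _), ?_⟩, hs⟩
      rw [← show (w : Multiset ℕ) = M from hw]
      exact Multiset.coe_eq_coe.2 hp
  · rintro w ⟨h, hw⟩ w' ⟨h', hw'⟩ hs
    exact minSkeleton_injOn R w w' m (hcons w hw h) (hcons w' hw' h')
      (Multiset.coe_eq_coe.1 (hw.trans hw'.symm)) hs

theorem avoids123_iff (w : List ℕ) : Avoids123 w ↔ AvoidsMinFirst (· < ·) w := by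
  constructor
  · rintro h a b c hs ⟨h1, -, h3⟩
    exact h a b c hs ⟨h1, h3⟩
  · rintro h a b c hs ⟨h1, h2⟩
    exact h a b c hs ⟨h1, h1.trans h2, h2⟩

theorem avoids231_reverse_iff (w : List ℕ) : Avoids231 w.reverse ↔ AvoidsMinFirst (· > ·) w := by
  have key : ∀ a b c : ℕ, [b, c, a].Sublist w.reverse ↔ [a, c, b].Sublist w := by
    intro a b c
    rw [← List.reverse_sublist]
    simp
  constructor
  · rintro h a b c hs ⟨h1, h2, h3⟩
    exact h a c b ((key a c b).2 hs) ⟨h2, h3⟩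
  · rintro h a b c hs ⟨h1, h2⟩
    exact h a c b ((key a b c).1 hs) ⟨h1.trans h2, h1, h2⟩

theorem ncard_wordsWith_image {p q : List ℕ → Prop} {M N : Multiset ℕ} (f : List ℕ → List ℕ)
    (hf : Set.InjOn f (wordsWith p M)) (h : ∀ w ∈ wordsWith p M, f w ∈ wordsWith q N) :
    (wordsWith p M).ncard ≤ (wordsWith q N).ncard :=
  Set.ncard_le_ncard_of_injOn f h hf (finite_wordsWith q N)

/-- On words with a given letter multiset, `123` and `231` are equally often avoided. -/
theorem ncard_avoids123_eq_avoids231 (M : Multiset ℕ) :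
    (wordsWith Avoids123 M).ncard = (wordsWith Avoids231 M).ncard := by
  obtain ⟨m, hm⟩ : ∃ m, ∀ a ∈ M, a ≤ m := ⟨M.sum, fun a ha => Multiset.single_le_sum
    (fun _ _ => Nat.zero_le _) a ha⟩
  have h1 : wordsWith Avoids123 M = wordsWith (AvoidsMinFirst (· < ·)) M := by
    ext w; exact and_congr_left fun _ => avoids123_iff w
  rw [h1, ncard_wordsWith_avoidsMinFirst _ M hm, ← ncard_wordsWith_avoidsMinFirst (· > ·) M hm]
  refine le_antisymm ?_ ?_
  · refine ncard_wordsWith_image List.reverse List.reverse_injective.injOn ?_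
    rintro w ⟨h, hw⟩
    exact ⟨(avoids231_reverse_iff w).2 h, by simpa using hw⟩
  · refine ncard_wordsWith_image List.reverse List.reverse_injective.injOn ?_
    rintro w ⟨h, hw⟩
    exact ⟨(avoids231_reverse_iff _).1 (by simpa using h), by simpa using hw⟩

theorem ncard_avoids123_le_compl (M : Multiset ℕ) {N : ℕ} (hM : ∀ a ∈ M, a ≤ N) :
    (wordsWith Avoids123 M).ncard ≤ (wordsWith Avoids123 (M.map (N - ·))).ncard := by
  have hle : ∀ w ∈ wordsWith Avoids123 M, ∀ a ∈ w, a ≤ N := by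
    rintro w ⟨_, rfl⟩ a ha
    exact hM a ha
  have hback : ∀ w : List ℕ, (∀ a ∈ w, a ≤ N) → (w.map (N - ·)).map (N - ·) = w := by
    intro w hw
    rw [List.map_map]
    conv_rhs => rw [← List.map_id w]
    exact List.map_congr_left fun a ha => Nat.sub_sub_self (hw a ha)
  refine ncard_wordsWith_image (fun w => (w.map (N - ·)).reverse) ?_ ?_
  · intro w hw w' hw' h
    have h' := List.reverse_injective h
    rw [← hback w (hle w hw), ← hback w' (hle w' hw'), h']
  · rintro w hw
    refine ⟨?_, by simp [← hw.2]⟩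
    intro a b c hs
    rw [← List.reverse_sublist, List.reverse_reverse] at hs
    have hs2 := hs.map (N - ·)
    rw [hback w (hle w hw)] at hs2
    have hmem : ∀ x ∈ [a, b, c].reverse, x ≤ N := by
      intro x hx
      obtain ⟨y, _, rfl⟩ := List.mem_map.1 (hs.subset hx)
      exact Nat.sub_le _ _
    have := hw.1 _ _ _ (by simpa using hs2)
    simp only [List.mem_reverse, List.mem_cons, List.not_mem_nil, or_false, forall_eq_or_imp,
      forall_eq] at hmem
    omega

/-- Reverse-complement preserves the pattern 123 but not 231, so this symmetry holds only for the
numbers and is obtained by passing through 123. -/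
theorem ncard_avoids231_compl (M : Multiset ℕ) {N : ℕ} (hM : ∀ a ∈ M, a ≤ N) :
    (wordsWith Avoids231 (M.map (N - ·))).ncard = (wordsWith Avoids231 M).ncard := by
  rw [← ncard_avoids123_eq_avoids231, ← ncard_avoids123_eq_avoids231]
  refine le_antisymm ?_ (ncard_avoids123_le_compl M hM)
  refine (ncard_avoids123_le_compl (M.map (N - ·)) (N := N) ?_).trans_eq ?_
  · intro a ha
    obtain ⟨b, _, rfl⟩ := Multiset.mem_map.1 ha
    exact Nat.sub_le _ _
  · congr 2
    rw [Multiset.map_map]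
    conv_rhs => rw [← Multiset.map_id M]
    exact Multiset.map_congr rfl fun a ha => Nat.sub_sub_self (hM a ha)

/-- The number of `231`-avoiding words only depends on the order type of the letters. -/
theorem ncard_avoids231_map (M : Multiset ℕ) (k : ℕ) :
    (wordsWith Avoids231 (M.map (· + k))).ncard = (wordsWith Avoids231 M).ncard := by
  have hback : ∀ w : List ℕ, (w.map (· + k)).map (· - k) = w := by
    intro w
    rw [List.map_map]
    conv_rhs => rw [← List.map_id w]
    exact List.map_congr_left fun a _ => by simp
  refine le_antisymm ?_ ?_
  · have hge : ∀ w ∈ wordsWith Avoids231 (M.map (· + k)), (w.map (· - k)).map (· + k) = w := by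
      rintro w ⟨_, hw⟩
      rw [List.map_map]
      conv_rhs => rw [← List.map_id w]
      refine List.map_congr_left fun a ha => ?_
      have ha' : a ∈ M.map (· + k) := hw ▸ ha
      obtain ⟨b, _, rfl⟩ := Multiset.mem_map.1 ha'
      simp
    refine ncard_wordsWith_image (List.map (· - k)) ?_ ?_
    · intro w hw w' hw' h
      rw [← hge w hw, ← hge w' hw', h]
    · rintro w hw
      refine ⟨?_, ?_⟩
      · rintro a b c hs ⟨h1, h2⟩
        refine hw.1 (a + k) (b + k) (c + k) ?_ ⟨by omega, by omega⟩
        have := hs.map (· + k)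
        rwa [hge w hw] at this
      · rw [← Multiset.map_coe, hw.2, Multiset.map_map]
        conv_rhs => rw [← Multiset.map_id M]
        exact Multiset.map_congr rfl fun a _ => by simp
  · refine ncard_wordsWith_image (List.map (· + k)) ?_ ?_
    · intro w _ w' _ h
      rw [← hback w, ← hback w', h]
    · rintro w ⟨h, hw⟩
      refine ⟨?_, by rw [← hw]; rfl⟩
      rintro a b c hs ⟨h1, h2⟩
      have := hs.map (· - k)
      rw [hback w] at this
      have hmem : ∀ x ∈ [b, c, a], k ≤ x := by
        intro x hx
        obtain ⟨y, _, rfl⟩ := List.mem_map.1 (hs.subset hx)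
        exact Nat.le_add_left _ _
      simp only [List.mem_cons, List.not_mem_nil, or_false, forall_eq_or_imp, forall_eq] at hmem
      refine h _ _ _ this ⟨?_, ?_⟩
      · show a - k < b - k
        omega
      · show b - k < c - k
        omega

/-! ### Splitting at the first largest letter. -/

theorem avoids231_append_cons {u v : List ℕ} {N : ℕ} (hu : Avoids231 u) (hv : Avoids231 v)
    (huv : ∀ b ∈ u, ∀ a ∈ N :: v, b ≤ a) (hN : ∀ a ∈ v, a ≤ N) : Avoids231 (u ++ N :: v) := by
  rintro a b c hs ⟨hab, hbc⟩
  obtain ⟨l₁, l₂, hl, h₁, h₂⟩ := List.sublist_append_iff.1 hs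
  rcases l₁ with _ | ⟨x, _ | ⟨y, _ | ⟨z, l₁⟩⟩⟩
  · obtain rfl : [b, c, a] = l₂ := by simpa using hl
    cases h₂ with
    | cons _ h => exact hv a b c h ⟨hab, hbc⟩
    | cons_cons _ h => exact absurd (hN c (h.subset (by simp))) (by omega)
  · simp only [List.cons_append, List.nil_append, List.cons.injEq] at hl
    obtain ⟨rfl, rfl⟩ := hl
    exact absurd (huv b (h₁.subset (by simp)) a (h₂.subset (by simp))) (by omega)
  · simp only [List.cons_append, List.nil_append, List.cons.injEq] at hl
    obtain ⟨rfl, rfl, rfl⟩ := hl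
    exact absurd (huv b (h₁.subset (by simp)) a (h₂.subset (by simp))) (by omega)
  · simp only [List.cons_append, List.cons.injEq, List.nil_eq, List.append_eq_nil_iff] at hl
    obtain ⟨rfl, rfl, rfl, rfl, rfl⟩ := hl
    exact hu _ _ _ h₁ ⟨hab, hbc⟩

theorem Avoids231.of_sublist {w w' : List ℕ} (h : Avoids231 w) (hw : w'.Sublist w) :
    Avoids231 w' :=
  fun a b c habc => h a b c (habc.trans hw)

/-- Splitting a `231`-avoiding word at the first occurrence of its largest letter `N`: the letters
before it form an initial segment of the sorted list of the other letters. -/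
theorem exists_split_of_avoids231 {l : List ℕ} {N j : ℕ} (hl : l.Pairwise (· ≤ ·))
    (hN : ∀ a ∈ l, a < N) {w : List ℕ}
    (hw : w ∈ wordsWith Avoids231 (l + Multiset.replicate (j + 1) N)) :
    ∃ u v, w = u ++ N :: v ∧ u.length ≤ l.length ∧
      u ∈ wordsWith Avoids231 (l.take u.length) ∧
      v ∈ wordsWith Avoids231 (l.drop u.length + Multiset.replicate j N) := by
  obtain ⟨hav, hM⟩ := hw
  have hNw : N ∈ w := by
    have : N ∈ (w : Multiset ℕ) := by rw [hM]; simp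
    simpa using this
  have hle : ∀ a ∈ w, a ≤ N := by
    intro a ha
    have : a ∈ (w : Multiset ℕ) := ha
    rw [hM, Multiset.mem_add, Multiset.mem_replicate] at this
    rcases this with h | h
    · exact (hN a h).le
    · exact h.2.le
  obtain ⟨u, v, rfl, hNu⟩ := List.eq_append_cons_of_mem hNw
  have huN : ∀ b ∈ u, b < N := fun b hb =>
    lt_of_le_of_ne (hle b (by simp [hb])) (fun h => hNu (h ▸ hb))
  -- Otherwise `b N a` would be an occurrence of 231.
  have huv : ∀ b ∈ u, ∀ a ∈ v, b ≤ a := by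
    intro b hb a ha
    by_contra hab
    refine hav a b N ?_ ⟨not_le.1 hab, huN b hb⟩
    exact (List.singleton_sublist.2 hb).append ((List.singleton_sublist.2 ha).cons_cons N)
  have hfl : (l : Multiset ℕ).filter (· ≠ N) = l :=
    Multiset.filter_eq_self.2 fun a ha => (hN a ha).ne
  have hfu : (u : Multiset ℕ).filter (· ≠ N) = u :=
    Multiset.filter_eq_self.2 fun a ha => (huN a ha).ne
  have hrep : ∀ k, (Multiset.replicate k N).filter (· ≠ N) = 0 := fun k =>
    Multiset.filter_eq_nil.2 fun a ha => by simp [Multiset.eq_of_mem_replicate ha]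
  have hM' : (u : Multiset ℕ) + (N ::ₘ (v : Multiset ℕ)) =
      l + (N ::ₘ Multiset.replicate j N) := by
    rw [← Multiset.replicate_succ, ← hM]; rfl
  set v₀ : Multiset ℕ := (v : Multiset ℕ).filter (· ≠ N) with hv₀
  have hsplit : (u : Multiset ℕ) + v₀ = l := by
    have := congrArg (Multiset.filter (· ≠ N)) hM'
    rwa [Multiset.filter_add, Multiset.filter_add, hfu, hfl,
      Multiset.filter_cons_of_neg _ (by simp), Multiset.filter_cons_of_neg _ (by simp), hrep,
      add_zero] at this
  have hv : (v : Multiset ℕ) = v₀ + Multiset.replicate j N := by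
    have h1 : (u : Multiset ℕ) + v = u + (v₀ + Multiset.replicate j N) := by
      rw [← add_assoc, hsplit]
      rw [Multiset.add_cons, Multiset.add_cons] at hM'
      exact (Multiset.cons_inj_right N).1 hM'
    exact add_left_cancel h1
  have hsorted : (u : Multiset ℕ).sort (· ≤ ·) ++ v₀.sort (· ≤ ·) = l := by
    refine List.Perm.eq_of_pairwise' (r := (· ≤ ·)) ?_ hl ?_
    · rw [List.pairwise_append]
      refine ⟨Multiset.pairwise_sort _ _, Multiset.pairwise_sort _ _, ?_⟩
      intro b hb a ha
      rw [Multiset.mem_sort] at hb ha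
      exact huv b hb a (Multiset.mem_of_mem_filter ha)
    · rw [← Multiset.coe_eq_coe, ← Multiset.coe_add, Multiset.sort_eq, Multiset.sort_eq, hsplit]
  have hlen : ((u : Multiset ℕ).sort (· ≤ ·)).length = u.length := by simp
  have htake : l.take u.length = (u : Multiset ℕ).sort (· ≤ ·) := by
    rw [← hsorted, ← hlen, List.take_left]
  have hdrop : l.drop u.length = v₀.sort (· ≤ ·) := by
    rw [← hsorted, ← hlen, List.drop_left]
  refine ⟨u, v, rfl, ?_, ⟨hav.of_sublist (List.sublist_append_left _ _), ?_⟩,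
    ⟨hav.of_sublist ((List.sublist_cons_self _ _).trans (List.sublist_append_right _ _)), ?_⟩⟩
  · rw [← hsorted, List.length_append, hlen]; exact Nat.le_add_right _ _
  · rw [htake, Multiset.sort_eq]
  · rw [hdrop, Multiset.sort_eq, hv]

/-- Once its length `p` is fixed, the prefix has forced content, and any avoiding prefix and suffix
recombine. The map is injective because the first `N` marks the cut. -/
theorem ncard_avoids231_split {l : List ℕ} {N : ℕ} (j : ℕ) (hl : l.Pairwise (· ≤ ·))
    (hN : ∀ a ∈ l, a < N) :
    (wordsWith Avoids231 (l + Multiset.replicate (j + 1) N)).ncard =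
      ∑ p ∈ Finset.range (l.length + 1), (wordsWith Avoids231 (l.take p)).ncard *
        (wordsWith Avoids231 (l.drop p + Multiset.replicate j N)).ncard := by
  have hc : ∀ M : Multiset ℕ, (wordsWith Avoids231 M).ncard =
      (finite_wordsWith Avoids231 M).toFinset.card := fun M =>
    Set.ncard_eq_toFinset_card _ _
  simp only [hc, ← Finset.card_product]
  rw [← Finset.card_sigma]
  symm
  refine Finset.card_bij (fun x _ => x.2.1 ++ N :: x.2.2) ?_ ?_ ?_
  · rintro ⟨p, u, v⟩ hx
    simp only [Finset.mem_sigma, Finset.mem_product, Set.Finite.mem_toFinset] at hx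
    obtain ⟨_, ⟨hu, hum⟩, hv, hvm⟩ := hx
    rw [Set.Finite.mem_toFinset]
    have hmu : ∀ b ∈ u, b ∈ l.take p := by
      intro b hb
      have : b ∈ (u : Multiset ℕ) := hb
      rwa [hum] at this
    have hmv : ∀ a ∈ v, a ∈ l.drop p ∨ a = N := by
      intro a ha
      have : a ∈ (v : Multiset ℕ) := ha
      rw [hvm, Multiset.mem_add] at this
      exact this.imp id Multiset.eq_of_mem_replicate
    have hl' := hl
    rw [← List.take_append_drop p l, List.pairwise_append] at hl'
    refine ⟨avoids231_append_cons hu hv ?_ ?_, ?_⟩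
    · intro b hb a ha
      have hbN := (hN b (List.mem_of_mem_take (hmu b hb))).le
      rcases List.mem_cons.1 ha with rfl | ha
      · exact hbN
      · rcases hmv a ha with h | rfl
        · exact hl'.2.2 b (hmu b hb) a h
        · exact hbN
    · intro a ha
      rcases hmv a ha with h | rfl
      · exact (hN a (List.mem_of_mem_drop h)).le
      · exact le_rfl
    · have : ((u ++ N :: v : List ℕ) : Multiset ℕ) = (u : Multiset ℕ) + (N ::ₘ (v : Multiset ℕ)) :=
        rfl
      rw [this, hum, hvm, Multiset.replicate_succ, Multiset.add_cons, Multiset.add_cons,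
        ← add_assoc, Multiset.coe_add, List.take_append_drop]
  · rintro ⟨p, u, v⟩ hx ⟨p', u', v'⟩ hx' h
    simp only [Finset.mem_sigma, Finset.mem_product, Set.Finite.mem_toFinset,
      Finset.mem_range] at hx hx'
    have key : ∀ (p : ℕ) (u : List ℕ), p < l.length + 1 → u ∈ wordsWith Avoids231 (l.take p) →
        N ∉ u ∧ u.length = p := by
      rintro p u hp ⟨_, hu⟩
      refine ⟨fun h => ?_, ?_⟩
      · have : N ∈ (u : Multiset ℕ) := h
        rw [hu] at this
        exact absurd (hN N (List.mem_of_mem_take this)) (lt_irrefl N)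
      · have := congrArg Multiset.card hu
        simp only [Multiset.coe_card, List.length_take] at this
        omega
    obtain ⟨h1, h2⟩ := key p u hx.1 hx.2.1
    obtain ⟨h1', h2'⟩ := key p' u' hx'.1 hx'.2.1
    have h : u ++ N :: v = u' ++ N :: v' := h
    have hlen := congrArg (List.idxOf N) h
    rw [List.idxOf_append_of_notMem h1, List.idxOf_append_of_notMem h1', List.idxOf_cons_self,
      List.idxOf_cons_self] at hlen
    obtain ⟨rfl, htail⟩ := List.append_inj h hlen
    obtain rfl : v = v' := (List.cons.inj htail).2
    subst h2 h2'
    rfl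
  · intro w hw
    rw [Set.Finite.mem_toFinset] at hw
    obtain ⟨u, v, rfl, hle, hu, hv⟩ := exists_split_of_avoids231 hl hN hw
    refine ⟨⟨u.length, u, v⟩, ?_, rfl⟩
    simp only [Finset.mem_sigma, Finset.mem_product, Set.Finite.mem_toFinset, Finset.mem_range]
    exact ⟨by omega, hu, hv⟩

/-! ### The recursion for the counts. -/

/-- The sorted list with `r` copies of each of `2, …, n + 1`. -/
def letterBlocks (r n : ℕ) : List ℕ :=
  (List.range n).flatMap fun k => List.replicate r (k + 2)

theorem letterBlocks_succ (r n : ℕ) :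
    letterBlocks r (n + 1) = letterBlocks r n ++ List.replicate r (n + 2) := by
  simp [letterBlocks, List.range_succ, List.flatMap_append]

theorem letterBlocks_add (r n m : ℕ) :
    letterBlocks r (n + m) = letterBlocks r n ++ (letterBlocks r m).map (· + n) := by
  induction m with
  | zero => simp [letterBlocks]
  | succ m ih =>
    rw [← add_assoc, letterBlocks_succ, ih, letterBlocks_succ, List.map_append,
      List.append_assoc, List.map_replicate, show n + m + 2 = m + 2 + n by omega]

theorem letterBlocks_succ' (r m : ℕ) :
    letterBlocks r (m + 1) = List.replicate r 2 ++ (letterBlocks r m).map (· + 1) := by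
  rw [add_comm, letterBlocks_add]
  simp [letterBlocks]

theorem length_letterBlocks (r n : ℕ) : (letterBlocks r n).length = r * n := by
  induction n with
  | zero => rfl
  | succ n ih => rw [letterBlocks_succ, List.length_append, ih, List.length_replicate]; ring

theorem mem_letterBlocks {r n a : ℕ} (h : a ∈ letterBlocks r n) : 2 ≤ a ∧ a < n + 2 := by
  simp only [letterBlocks, List.mem_flatMap, List.mem_range, List.mem_replicate] at h
  obtain ⟨k, hk, -, rfl⟩ := h
  omega

theorem pairwise_letterBlocks (r n : ℕ) : (letterBlocks r n).Pairwise (· ≤ ·) := by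
  induction n with
  | zero => exact List.Pairwise.nil
  | succ n ih =>
    rw [letterBlocks_succ, List.pairwise_append]
    refine ⟨ih, List.pairwise_replicate.2 (Or.inr le_rfl), ?_⟩
    intro a ha b hb
    rw [List.eq_of_mem_replicate hb]
    exact (mem_letterBlocks ha).2.le

/-- The letters of the words in `words231 r i j n`. -/
def contentMultiset (r i j n : ℕ) : Multiset ℕ :=
  (List.replicate i 1 ++ letterBlocks r n : List ℕ) + Multiset.replicate j (n + 2)

/-- The number of words in `words231 r i j n`. -/
noncomputable def count231 (r i j n : ℕ) : ℕ :=
  (wordsWith Avoids231 (contentMultiset r i j n)).ncard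

theorem map_add_contentMultiset (r i j n k : ℕ) :
    (contentMultiset r i j n).map (· + k) =
      (List.replicate i (1 + k) ++ (letterBlocks r n).map (· + k) : List ℕ) +
        Multiset.replicate j (n + 2 + k) := by
  simp only [contentMultiset, Multiset.map_add, Multiset.map_coe, List.map_append,
    List.map_replicate, Multiset.map_replicate]

theorem count231_last_full (r i n : ℕ) : count231 r i r n = count231 r i 0 (n + 1) := by
  unfold count231 contentMultiset
  congr 2
  rw [letterBlocks_succ, ← List.append_assoc, Multiset.replicate_zero, add_zero,
    ← Multiset.coe_add (_ ++ _), Multiset.coe_replicate]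

theorem wordsWith_replicate_one (p : ℕ) :
    (wordsWith Avoids231 (List.replicate p 1 : List ℕ)).ncard = 1 := by
  rw [Set.ncard_eq_one]
  refine ⟨List.replicate p 1, Set.eq_singleton_iff_unique_mem.2 ⟨⟨?_, rfl⟩, ?_⟩⟩
  · rintro a b c hs ⟨h1, -⟩
    have ha := List.eq_of_mem_replicate (hs.subset (show a ∈ [b, c, a] by simp))
    have hb := List.eq_of_mem_replicate (hs.subset (show b ∈ [b, c, a] by simp))
    omega
  · rintro w ⟨_, hw⟩
    exact List.perm_replicate.1 (Multiset.coe_eq_coe.1 hw)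

theorem count231_zero (r i : ℕ) : count231 r i 0 0 = 1 := by
  rw [← wordsWith_replicate_one i]
  simp [count231, contentMultiset, letterBlocks]

theorem Finset.sum_range_mul_add_one {M : Type*} [AddCommMonoid M] (F : ℕ → M) (r n : ℕ) :
    ∑ p ∈ Finset.range (r * n + 1), F p =
      (∑ k ∈ Finset.range n, ∑ t ∈ Finset.range r, F (r * k + t)) + F (r * n) := by
  rw [Finset.sum_range_succ]
  congr 1
  induction n with
  | zero => simp
  | succ n ih => rw [mul_add, mul_one, Finset.sum_range_add, ih, Finset.sum_range_succ]

/-- The three sums record where the cut falls in the sorted content: inside the letters 1, at the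
end of a complete block, or inside a block. In the last case `t + 1` copies end the prefix, as its
largest letter, and `r - t` copies start the suffix, as its smallest. -/
theorem count231_succ (r i j n : ℕ) :
    count231 (r + 1) i (j + 1) n = ∑ m ∈ Finset.range i, count231 (r + 1) (i - m) j n
      + ∑ k ∈ Finset.range (n + 1), count231 (r + 1) i 0 k * count231 (r + 1) 0 j (n - k)
      + ∑ t ∈ Finset.range r, ∑ k ∈ Finset.range n,
        count231 (r + 1) i (t + 1) k * count231 (r + 1) (r - t) j (n - 1 - k) := by
  have hsort : (List.replicate i 1 ++ letterBlocks (r + 1) n).Pairwise (· ≤ ·) := by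
    rw [List.pairwise_append]
    refine ⟨List.pairwise_replicate.2 (Or.inr le_rfl), pairwise_letterBlocks _ _, ?_⟩
    intro a ha b hb
    rw [List.eq_of_mem_replicate ha]
    have := (mem_letterBlocks hb).1
    omega
  have hlt : ∀ a ∈ List.replicate i 1 ++ letterBlocks (r + 1) n, a < n + 2 := by
    intro a ha
    rcases List.mem_append.1 ha with h | h
    · rw [List.eq_of_mem_replicate h]; omega
    · exact (mem_letterBlocks h).2
  have hfirst : ∀ m ∈ Finset.range i,
      (wordsWith Avoids231 ((List.replicate i 1 ++ letterBlocks (r + 1) n).take m)).ncard *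
        (wordsWith Avoids231 ((List.replicate i 1 ++ letterBlocks (r + 1) n).drop m +
          Multiset.replicate j (n + 2))).ncard = count231 (r + 1) (i - m) j n := by
    intro m hm
    have hm' : m ≤ i := (Finset.mem_range.1 hm).le
    rw [List.take_append_of_le_length (by simpa using hm'),
      List.drop_append_of_le_length (by simpa using hm'), List.take_replicate, min_eq_left hm',
      wordsWith_replicate_one, one_mul, List.drop_replicate]
    rfl
  have hfull : ∀ k, k ≤ n →
      (wordsWith Avoids231 ((List.replicate i 1 ++ letterBlocks (r + 1) n).take
          (i + (r + 1) * k))).ncard *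
        (wordsWith Avoids231 ((List.replicate i 1 ++ letterBlocks (r + 1) n).drop
          (i + (r + 1) * k) + Multiset.replicate j (n + 2))).ncard =
      count231 (r + 1) i 0 k * count231 (r + 1) 0 j (n - k) := by
    intro k hk
    obtain ⟨d, rfl⟩ := Nat.exists_eq_add_of_le hk
    have hlen : (List.replicate i 1 ++ letterBlocks (r + 1) k).length = i + (r + 1) * k := by
      simp [length_letterBlocks]
    rw [letterBlocks_add, ← List.append_assoc, ← hlen, List.take_left, List.drop_left,
      Nat.add_sub_cancel_left]
    congr 1
    · simp [count231, contentMultiset]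
    · rw [count231, ← ncard_avoids231_map (contentMultiset _ _ _ _) k, map_add_contentMultiset]
      congr 3
      · congr 1
        omega
  have hpart : ∀ k t, k < n → t < r →
      (wordsWith Avoids231 ((List.replicate i 1 ++ letterBlocks (r + 1) n).take
          (i + ((r + 1) * k + (t + 1))))).ncard *
        (wordsWith Avoids231 ((List.replicate i 1 ++ letterBlocks (r + 1) n).drop
          (i + ((r + 1) * k + (t + 1))) + Multiset.replicate j (n + 2))).ncard =
      count231 (r + 1) i (t + 1) k * count231 (r + 1) (r - t) j (n - 1 - k) := by
    intro k t hk ht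
    obtain ⟨d, rfl⟩ := Nat.exists_eq_add_of_lt hk
    have hsplit : List.replicate (r + 1) 2 =
        (List.replicate (t + 1) 2 ++ List.replicate (r - t) 2 : List ℕ) := by
      rw [List.replicate_append_replicate]; congr 1; omega
    have hlist : List.replicate i 1 ++ letterBlocks (r + 1) (k + d + 1) =
        (List.replicate i 1 ++ letterBlocks (r + 1) k ++ List.replicate (t + 1) (k + 2)) ++
        (List.replicate (r - t) (1 + (k + 1)) ++
          (letterBlocks (r + 1) d).map (· + (k + 1))) := by
      rw [add_assoc k d 1, letterBlocks_add, letterBlocks_succ', hsplit]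
      simp only [List.map_append, List.map_replicate, List.map_map, List.append_assoc]
      congr 3
      · congr 1; omega
      · congr 1
        · congr 1; omega
        · congr 1
          funext x
          simp only [Function.comp]
          omega
    have hlen : (List.replicate i 1 ++ letterBlocks (r + 1) k ++
        List.replicate (t + 1) (k + 2)).length = i + ((r + 1) * k + (t + 1)) := by
      simp [length_letterBlocks]
    rw [hlist, ← hlen, List.take_left, List.drop_left]
    congr 1
    have hd : k + d + 1 - 1 - k = d := by omega
    rw [hd, count231, ← ncard_avoids231_map (contentMultiset _ _ _ _) (k + 1),
      map_add_contentMultiset]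
    congr 3
    congr 1
    omega
  have hL : (List.replicate i 1 ++ letterBlocks (r + 1) n).length + 1 =
      i + ((r + 1) * n + 1) := by
    simp [length_letterBlocks]; ring
  have hmain := ncard_avoids231_split j hsort hlt
  rw [hL, Finset.sum_range_add, Finset.sum_congr rfl hfirst, Finset.sum_range_mul_add_one] at hmain
  rw [count231, contentMultiset, hmain, add_assoc]
  congr 1
  rw [hfull n le_rfl]
  have hk : ∀ k ∈ Finset.range n, ∑ t ∈ Finset.range (r + 1),
      (wordsWith Avoids231 ((List.replicate i 1 ++ letterBlocks (r + 1) n).take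
          (i + ((r + 1) * k + t)))).ncard *
        (wordsWith Avoids231 ((List.replicate i 1 ++ letterBlocks (r + 1) n).drop
          (i + ((r + 1) * k + t)) + Multiset.replicate j (n + 2))).ncard =
      (∑ t ∈ Finset.range r,
        count231 (r + 1) i (t + 1) k * count231 (r + 1) (r - t) j (n - 1 - k)) +
      count231 (r + 1) i 0 k * count231 (r + 1) 0 j (n - k) := by
    intro k hk
    rw [Finset.mem_range] at hk
    rw [Finset.sum_range_succ', add_zero, hfull k hk.le]
    congr 1
    exact Finset.sum_congr rfl fun t ht => hpart k t hk (Finset.mem_range.1 ht)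
  rw [Finset.sum_congr rfl hk, Finset.sum_add_distrib, Finset.sum_comm,
    Finset.sum_range_succ (fun k => count231 (r + 1) i 0 k * count231 (r + 1) 0 j (n - k))]
  ring

theorem coe_letterBlocks (r n : ℕ) :
    (letterBlocks r n : Multiset ℕ) =
      ∑ k ∈ Finset.range n, Multiset.replicate r (k + 2) := by
  induction n with
  | zero => rfl
  | succ n ih =>
    rw [letterBlocks_succ, ← Multiset.coe_add, ih, Finset.sum_range_succ, Multiset.coe_replicate]

theorem contentMultiset_compl (r i j n : ℕ) :
    (contentMultiset r i j n).map (n + 3 - ·) = contentMultiset r j i n := by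
  have h : (letterBlocks r n : Multiset ℕ).map (n + 3 - ·) = letterBlocks r n := by
    rw [coe_letterBlocks, ← Multiset.coe_mapAddMonoidHom, map_sum,
      ← Finset.sum_range_reflect]
    refine Finset.sum_congr rfl fun k hk => ?_
    rw [Finset.mem_range] at hk
    rw [Multiset.coe_mapAddMonoidHom, Multiset.map_replicate]
    congr 1
    omega
  simp only [contentMultiset, ← Multiset.coe_add, Multiset.map_add, h, Multiset.coe_replicate,
    Multiset.map_replicate]
  rw [show n + 3 - (n + 2) = 1 by omega, show n + 3 - 1 = n + 2 by omega]
  abel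

theorem count231_comm (r i j n : ℕ) : count231 r i j n = count231 r j i n := by
  have hle : ∀ a ∈ contentMultiset r i j n, a ≤ n + 3 := by
    intro a ha
    simp only [contentMultiset, Multiset.mem_add, Multiset.mem_coe, List.mem_append,
      List.mem_replicate, Multiset.mem_replicate] at ha
    rcases ha with (h | h) | h
    · omega
    · have := mem_letterBlocks h; omega
    · omega
  rw [count231, ← ncard_avoids231_compl _ hle, contentMultiset_compl, count231]

theorem count_letterBlocks (r n a : ℕ) :
    (letterBlocks r n).count a = if 2 ≤ a ∧ a ≤ n + 1 then r else 0 := by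
  induction n with
  | zero => rw [if_neg (by omega)]; rfl
  | succ n ih =>
    rw [letterBlocks_succ, List.count_append, ih, List.count_replicate]
    by_cases h : n + 2 = a
    · subst h
      simp
    · rw [if_neg (c := (n + 2 == a) = true) (by simpa using h), add_zero]
      congr 1
      simp only [eq_iff_iff]
      omega

theorem words231_eq_wordsWith (r i j n : ℕ) :
    words231 r i j n = wordsWith Avoids231 (contentMultiset r i j n) := by
  ext w
  refine and_congr_right fun _ => ?_
  rw [Multiset.ext]
  refine forall_congr' fun a => ?_
  have : (contentMultiset r i j n).count a =
      if a = 1 then i else if a = n + 2 then j else if 2 ≤ a ∧ a ≤ n + 1 then r else 0 := by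
    rw [contentMultiset, Multiset.count_add, Multiset.coe_count, List.count_append,
      List.count_replicate, count_letterBlocks, Multiset.count_replicate]
    by_cases h1 : a = 1
    · subst h1; simp
    · by_cases h2 : a = n + 2
      · subst h2; simp
      · simp [h1, h2, Ne.symm h1, Ne.symm h2]
  rw [this, Multiset.coe_count]

theorem ncard_words123 (r n : ℕ) : (words123 r n).ncard = count231 r 0 0 n := by
  have h : words123 r n =
      wordsWith Avoids123 (∑ k ∈ Finset.range n, Multiset.replicate r (k + 1)) := by
    ext w
    refine and_congr_right fun _ => ?_
    rw [Multiset.ext]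
    refine forall_congr' fun a => ?_
    have : (∑ k ∈ Finset.range n, Multiset.replicate r (k + 1)).count a =
        if 1 ≤ a ∧ a ≤ n then r else 0 := by
      rw [Multiset.count_sum']
      simp only [Multiset.count_replicate]
      by_cases ha : 1 ≤ a ∧ a ≤ n
      · rw [if_pos ha, Finset.sum_eq_single (a - 1)]
        · rw [if_pos (by omega)]
        · intro b _ hb; rw [if_neg (by omega)]
        · intro h; exact absurd (Finset.mem_range.2 (by omega)) h
      · rw [if_neg ha]
        refine Finset.sum_eq_zero fun k hk => if_neg ?_
        rw [Finset.mem_range] at hk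
        omega
    rw [this, Multiset.coe_count]
  rw [h, ncard_avoids123_eq_avoids231, ← ncard_avoids231_map _ 1, count231]
  congr 2
  rw [← Multiset.coe_mapAddMonoidHom, map_sum]
  simp only [Multiset.coe_mapAddMonoidHom, Multiset.map_replicate, contentMultiset,
    List.replicate_zero, List.nil_append, Multiset.replicate_zero, add_zero, coe_letterBlocks]

/-! ### Generating functions and the ten equations. -/

/-- The generating function, in the number of middle letters, of the numbers `count231 r i j n`. -/
noncomputable def countSeries (r i j : ℕ) : ℤ⟦X⟧ :=
  PowerSeries.mk fun n => (count231 r i j n : ℤ)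

theorem countSeries_comm (r i j : ℕ) : countSeries r i j = countSeries r j i := by
  simp only [countSeries, count231_comm r i j]

theorem genFun123_eq (r : ℕ) : genFun123 r = countSeries r 0 0 := by
  simp only [genFun123, countSeries, ncard_words123]

/-- A largest letter with full multiplicity is just one more middle letter. This closes the
recursion, since index `r` is expressed through index 0; the 1 is the term with no middle letter. -/
theorem X_mul_countSeries_last (r i : ℕ) :
    PowerSeries.X * countSeries r i r = countSeries r i 0 - 1 := by
  ext n
  cases n with
  | zero => simp [countSeries, count231_zero]
  | succ n => simp [countSeries, count231_last_full, PowerSeries.coeff_one]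

theorem countSeries_succ (r i j : ℕ) :
    countSeries (r + 1) i (j + 1) =
      ∑ m ∈ Finset.range i, countSeries (r + 1) (i - m) j
        + countSeries (r + 1) i 0 * countSeries (r + 1) 0 j
        + PowerSeries.X * ∑ t ∈ Finset.range r,
            countSeries (r + 1) i (t + 1) * countSeries (r + 1) (r - t) j := by
  ext n
  rw [map_add, map_add, map_sum]
  simp only [countSeries, PowerSeries.coeff_mk]
  rw [count231_succ]
  push_cast
  congr 1
  · congr 1
    rw [PowerSeries.coeff_mul, Finset.Nat.sum_antidiagonal_eq_sum_range_succ_mk]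
    simp
  · cases n with
    | zero => simp
    | succ n =>
      rw [PowerSeries.coeff_succ_X_mul, map_sum]
      refine Finset.sum_congr rfl fun t _ => ?_
      rw [PowerSeries.coeff_mul, Finset.Nat.sum_antidiagonal_eq_sum_range_succ_mk]
      simp

theorem length_of_mem_words231 {r i j n : ℕ} {w : List ℕ} (h : w ∈ words231 r i j n) :
    w.length = i + j + r * n := by
  rw [words231_eq_wordsWith] at h
  have := congrArg Multiset.card h.2
  simp only [contentMultiset, Multiset.coe_card, Multiset.card_add, List.length_append,
    List.length_replicate, length_letterBlocks, Multiset.card_replicate] at this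
  omega

theorem weightEnum_eq {r : ℕ} (hr : r ≠ 0) (i j : ℕ) :
    weightEnum r i j = PowerSeries.X ^ (i + j) * PowerSeries.expand r hr (countSeries r i j) := by
  ext N
  rw [weightEnum, PowerSeries.coeff_mk, PowerSeries.coeff_X_pow_mul', PowerSeries.coeff_expand]
  by_cases h : i + j ≤ N ∧ r ∣ N - (i + j)
  · obtain ⟨h1, n, hn⟩ := h
    rw [if_pos h1, if_pos ⟨n, hn⟩, hn, Nat.mul_div_cancel_left _ (Nat.pos_of_ne_zero hr),
      countSeries, PowerSeries.coeff_mk, count231, ← words231_eq_wordsWith]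
    congr 2
    ext w
    constructor
    · rintro ⟨⟨m, hm⟩, hw⟩
      have := length_of_mem_words231 hm
      have hmn : r * m = r * n := by omega
      rwa [← Nat.eq_of_mul_eq_mul_left (Nat.pos_of_ne_zero hr) hmn]
    · intro hw
      refine ⟨⟨n, hw⟩, ?_⟩
      rw [length_of_mem_words231 hw]
      omega
  · have hempty : {w | (∃ n, w ∈ words231 r i j n) ∧ w.length = N} = ∅ := by
      rw [Set.eq_empty_iff_forall_notMem]
      rintro w ⟨⟨m, hm⟩, hw⟩
      have := length_of_mem_words231 hm
      exact h ⟨by omega, m, by omega⟩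
    rw [hempty, Set.ncard_empty]
    by_cases h1 : i + j ≤ N
    · rw [if_pos h1, if_neg fun h2 => h ⟨h1, h2⟩]; rfl
    · rw [if_neg h1]; rfl

theorem weightEnumFamily_mk {r : ℕ} (hr : r ≠ 0) (i j : Fin r) :
    weightEnumFamily r s(i, j) = PowerSeries.X ^ ((i : ℕ) + j) *
      PowerSeries.expand r hr (countSeries r i j) := by
  rw [weightEnumFamily, Sym2.inf_mk, Sym2.sup_mk, weightEnum_eq hr]
  rcases le_total i j with h | h
  · rw [inf_eq_left.2 h, sup_eq_right.2 h]
  · rw [inf_eq_right.2 h, sup_eq_left.2 h, countSeries_comm, add_comm]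

theorem weightEnumFamily_zero :
    weightEnumFamily 4 s(0, 0) = PowerSeries.expand 4 (by norm_num) (genFun123 4) := by
  rw [weightEnumFamily_mk (by norm_num), genFun123_eq]
  simp

theorem aeval_schemeEq (i j : Fin 4) (hij : i ≤ j) :
    MvPolynomial.aeval (weightEnumFamily 4) (schemeEq 4 i j) = 0 := by
  have h4 : (4 : ℕ) ≠ 0 := by norm_num
  have hX : PowerSeries.expand 4 h4 (PowerSeries.X : ℤ⟦X⟧) = PowerSeries.X ^ 4 :=
    PowerSeries.expand_X 4 h4
  have hrec := fun i j => congrArg (PowerSeries.expand 4 h4) (countSeries_succ 3 i j)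
  have hlast := congrArg (PowerSeries.expand 4 h4) (X_mul_countSeries_last 4 0)
  simp only [map_add, map_mul, map_sum, map_sub, map_one, hX, Finset.sum_range_succ,
    Finset.sum_range_zero, zero_add, Nat.reduceAdd, Nat.reduceSub] at hrec hlast
  have hA : algebraMap ℤ[X] ℤ⟦X⟧ Polynomial.X = PowerSeries.X := by
    rw [PowerSeries.algebraMap_apply']; simp
  have h1 : (-1 : Fin 4) = 3 := rfl
  have h2 : (-2 : Fin 4) = 2 := rfl
  have h3 : (-3 : Fin 4) = 1 := rfl
  fin_cases i <;> fin_cases j <;> first | exact absurd hij (by decide) | skip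
  all_goals simp [schemeEq, Fin.sum_univ_four, weightEnumFamily_mk h4, Finset.sum_range_succ,
    h1, h2, h3, hA, -Fin.ofNat_eq_cast]
  -- Only here does `j - 1` wrap around: the recursion produces index 4, which `hlast` converts back
  -- to index 0.
  · have h := hrec 0 3
    simp only [Finset.sum_range_zero, zero_add, Nat.reduceAdd] at h
    linear_combination PowerSeries.X ^ 4 * h - hlast
  · have h := hrec 0 0
    simp at h
    linear_combination PowerSeries.X ^ 1 * h
  · have h := hrec 0 1
    simp at h
    linear_combination PowerSeries.X ^ 2 * h
  · have h := hrec 0 2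
    simp at h
    linear_combination PowerSeries.X ^ 3 * h
  · have h := hrec 1 0
    simp at h
    linear_combination PowerSeries.X ^ 2 * h
  · have h := hrec 1 1
    simp at h
    linear_combination PowerSeries.X ^ 3 * h
  · have h := hrec 1 2
    simp at h
    linear_combination PowerSeries.X ^ 4 * h
  · have h := hrec 2 1
    simp [Finset.sum_range_succ] at h
    linear_combination PowerSeries.X ^ 4 * h
  · have h := hrec 2 2
    simp [Finset.sum_range_succ] at h
    linear_combination PowerSeries.X ^ 5 * h
  · have h := hrec 3 2
    simp [Finset.sum_range_succ] at h
    linear_combination PowerSeries.X ^ 6 * h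

/-! ### Elimination by a matrix square root. -/

/-- If `X * X = s • B` for `4 × 4` matrices, and `e₁, …, e₄` are the elementary symmetric functions
of the eigenvalues of `B`, then the trace of `X` satisfies an equation of degree `16`. -/
theorem Matrix.trace_eq_of_mul_self {K : Type*} [Field K] [CharZero K]
    (X B : Matrix (Fin 4) (Fin 4) K) (s e₁ e₂ e₃ e₄ : K) (hs : s ≠ 0) (hX : X * X = s • B)
    (hB : ∀ t : K, (t • (1 : Matrix (Fin 4) (Fin 4) K) - s • B).det =
      t ^ 4 - s * e₁ * t ^ 3 + s ^ 2 * e₂ * t ^ 2 - s ^ 3 * e₃ * t + s ^ 4 * e₄)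
    (f : K) (hf : X.trace = s * f) :
    (((s * f ^ 2 - e₁) ^ 2 / 4 - e₂) ^ 2 + 4 * e₄ - 4 * s * f ^ 2 * e₃) ^ 2 =
      e₄ * (4 * ((s * f ^ 2 - e₁) ^ 2 / 4 - e₂) - 4 * s * f ^ 2 * (s * f ^ 2 - e₁)) ^ 2 := by
  obtain ⟨a, b, c, hq⟩ : ∃ a b c : K, ∀ t : K, (t • (1 : Matrix (Fin 4) (Fin 4) K) - X).det =
      t ^ 4 - s * f * t ^ 3 + a * t ^ 2 - b * t + c := by
    refine ⟨X.charpoly.coeff 2, -X.charpoly.coeff 1, X.charpoly.coeff 0, fun t => ?_⟩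
    have h1 : (t • (1 : Matrix (Fin 4) (Fin 4) K) - X).det = X.charpoly.eval t := by
      rw [Matrix.eval_charpoly, Matrix.scalar_apply, Matrix.smul_one_eq_diagonal]
    have h2 : X.charpoly.natDegree = 4 := by simp
    have h3 : X.charpoly.coeff 4 = 1 := by
      have := X.charpoly_monic.coeff_natDegree
      rwa [h2] at this
    have h4 : X.charpoly.coeff 3 = -(s * f) := by
      rw [← hf, Matrix.trace_eq_neg_charpoly_coeff]; simp
    rw [h1, Polynomial.eval_eq_sum_range, h2]
    simp only [Finset.sum_range_succ, Finset.sum_range_zero, h3, h4]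
    ring
  -- With `q` the characteristic polynomial of `X`, this is `det(t² - X²) = q(t) q(-t)`. The leading
  -- terms cancel, so the values at 0, 1, 2, 3 determine the remaining coefficients in `t²`.
  have key : ∀ t : K, (t ^ 2) ^ 4 - s * e₁ * (t ^ 2) ^ 3 + s ^ 2 * e₂ * (t ^ 2) ^ 2
      - s ^ 3 * e₃ * t ^ 2 + s ^ 4 * e₄ =
      (t ^ 4 - s * f * t ^ 3 + a * t ^ 2 - b * t + c) *
        (t ^ 4 + s * f * t ^ 3 + a * t ^ 2 + b * t + c) := by
    intro t
    have h1 : (t ^ 2) • (1 : Matrix (Fin 4) (Fin 4) K) - s • B =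
        (t • (1 : Matrix (Fin 4) (Fin 4) K) - X) *
          (-((-t) • (1 : Matrix (Fin 4) (Fin 4) K) - X)) := by
      rw [← hX]
      simp only [neg_smul, mul_neg, sub_mul, mul_sub, smul_mul_assoc, mul_smul_comm, one_mul,
        mul_one, smul_sub, smul_smul, neg_sub]
      rw [pow_two]
      abel
    rw [← hB, h1, Matrix.det_mul, Matrix.det_neg, hq, hq]
    simp only [Fintype.card_fin]
    ring
  have k0 := key 0
  have k1 := key 1
  have k2 := key 2
  have k3 := key 3
  have hc : s ^ 4 * e₄ = c ^ 2 := by linear_combination k0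
  have h1 : s * e₁ = (s * f) ^ 2 - 2 * a := by
    linear_combination (-1 / 360 : K) * (k3 - k0) + (1 / 60 : K) * (k2 - k0)
      - (1 / 24 : K) * (k1 - k0)
  have h2 : s ^ 2 * e₂ = a ^ 2 - 2 * (s * f) * b + 2 * c := by
    linear_combination (1 / 12 : K) * (k2 - k0) - (1 / 3 : K) * (k1 - k0) + 5 * h1
  have h3 : s ^ 3 * e₃ = b ^ 2 - 2 * a * c := by
    linear_combination -(k1 - k0) - h1 + h2
  have ha : a = s * ((s * f ^ 2 - e₁) / 2) := by linear_combination (1 / 2 : K) * h1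
  subst ha
  -- `h2` is linear in `b`; squaring it and using `h3` removes `b`. With `hc` the result is linear
  -- in `c`, so one more squaring removes `c`.
  have hlin : s ^ 2 * (((s * f ^ 2 - e₁) ^ 2 / 4 - e₂) ^ 2 + 4 * e₄ - 4 * s * f ^ 2 * e₃) =
      -c * (4 * ((s * f ^ 2 - e₁) ^ 2 / 4 - e₂) - 4 * s * f ^ 2 * (s * f ^ 2 - e₁)) := by
    refine mul_left_cancel₀ (pow_ne_zero 2 hs) ?_
    linear_combination 4 * hc - 4 * s ^ 2 * f ^ 2 * h3
      - (s ^ 2 * ((s * f ^ 2 - e₁) ^ 2 / 4 - e₂) + 2 * c + 2 * (s * f) * b) * h2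
  refine mul_left_cancel₀ (pow_ne_zero 4 hs) ?_
  linear_combination (s ^ 2 * (((s * f ^ 2 - e₁) ^ 2 / 4 - e₂) ^ 2 + 4 * e₄ - 4 * s * f ^ 2 * e₃)
    - c * (4 * ((s * f ^ 2 - e₁) ^ 2 / 4 - e₂) - 4 * s * f ^ 2 * (s * f ^ 2 - e₁))) * hlin
    - (4 * ((s * f ^ 2 - e₁) ^ 2 / 4 - e₂) - 4 * s * f ^ 2 * (s * f ^ 2 - e₁)) ^ 2 * hc

section

variable {K : Type*} [Field K]

/-- The matrix of multiplication by `w` modulo `w ^ 4 - y w ^ 2 + 3 y w - y`, in a suitable basis. -/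
def kernelMatrix (y : K) : Matrix (Fin 4) (Fin 4) K :=
  !![0, 1, -1, 0; 0, 0, 1, -1; -y, 0, 0, 1; y, 0, 0, 0]

/-- A solution `M` of a matrix Riccati equation gives a solution of the quadratic equation
`V - V * V = W`. -/
theorem Matrix.sub_mul_self_of_riccati {n : Type*} [Fintype n] [DecidableEq n]
    {M C U T E W : Matrix n n K} (hric : M * C = M * U * M + T * M + E)
    (h1 : (1 - W * C) * U = W * U * T) (h2 : (1 - W * C) * C + W * U * E = 1) :
    (W * (U * M - C) + 1) - (W * (U * M - C) + 1) * (W * (U * M - C) + 1) = W := by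
  obtain ⟨Z, hZ⟩ : ∃ Z, Z = U * M - C := ⟨_, rfl⟩
  rw [← hZ]
  have hMZ : M * Z = -(T * M + E) := by
    rw [hZ, mul_sub, hric]
    noncomm_ring
  -- The Riccati equation makes `M * Z` affine in `M`, and `h1` cancels the terms still containing
  -- `M`. Thus `-Z` inverts `W * Z + 1` on one side, hence on both since the matrices are square.
  have hWZ : (W * Z + 1) * Z = -1 := by
    calc (W * Z + 1) * Z = W * U * (M * Z) + (1 - W * C) * U * M - (1 - W * C) * C := by
          rw [hZ]; noncomm_ring
      _ = -((1 - W * C) * C + W * U * E) := by rw [hMZ, h1]; noncomm_ring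
      _ = -1 := by rw [h2]
  have hZV : Z * (W * Z + 1) = -1 := by
    have : (-(W * Z + 1)) * Z = 1 := by rw [neg_mul, hWZ, neg_neg]
    have := mul_eq_one_comm.1 this
    rw [mul_neg] at this
    rw [← neg_neg (Z * _), this]
  have : (W * Z + 1) * (W * Z + 1) = W * (Z * (W * Z + 1)) + (W * Z + 1) := by noncomm_ring
  rw [this, hZV]
  noncomm_ring

-- Written as `W (C U + U T) = U` with `U` invertible, this identity determines `W` as the inverse
-- of `C + U T U⁻¹`; that is the origin of `kernelMatrix`.
set_option maxHeartbeats 1000000 in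
theorem one_sub_kernelMatrix_mul (y : K) (hy : y ≠ 0) :
    (1 - kernelMatrix y * !![0, 0, 0, y⁻¹; 1, 0, 0, 0; 0, 1, 0, 0; 0, 0, 1, 0]) *
        !![1, 0, 0, 0; 0, 0, 0, y; 0, 0, y, 0; 0, y, 0, 0] =
      kernelMatrix y * !![1, 0, 0, 0; 0, 0, 0, y; 0, 0, y, 0; 0, y, 0, 0] *
        !![0, 0, 0, 0; 0, 1, 0, 0; 0, 1, 1, 0; 0, 1, 1, 1] := by
  ext i j
  fin_cases i <;> fin_cases j <;>
    simp [kernelMatrix, Matrix.mul_apply, Fin.sum_univ_four, hy]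

set_option maxHeartbeats 1000000 in
theorem one_sub_kernelMatrix_mul_add (y : K) (hy : y ≠ 0) :
    (1 - kernelMatrix y * !![0, 0, 0, y⁻¹; 1, 0, 0, 0; 0, 1, 0, 0; 0, 0, 1, 0]) *
        !![0, 0, 0, y⁻¹; 1, 0, 0, 0; 0, 1, 0, 0; 0, 0, 1, 0] +
      kernelMatrix y * !![1, 0, 0, 0; 0, 0, 0, y; 0, 0, y, 0; 0, y, 0, 0] *
        (Matrix.of fun _ j => if j = 3 then y⁻¹ else 0) = 1 := by
  ext i j
  fin_cases i <;> fin_cases j <;>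
    simp [kernelMatrix, Matrix.mul_apply, Fin.sum_univ_four, Matrix.vecHead, Matrix.vecTail, hy]

/-- In the Riccati equation, right multiplication by `C` shifts the second index, `U` carries the
pairing of `t` with `-t` modulo 4, `T` gives the sum over `m`, and `E` corrects the wrap-around
column. -/
theorem exists_matrix_of_riccati (y : K) (hy : y ≠ 0) (H : ℕ → ℕ → K)
    (hrec : ∀ i j, H i (j + 1) = ∑ m ∈ Finset.range i, H (i - m) j
      + H i 0 * H 0 j + y * (H i 1 * H 3 j + H i 2 * H 2 j + H i 3 * H 1 j))
    (hlast : ∀ i, y * H i 4 = H i 0 - 1) :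
    ∃ V : Matrix (Fin 4) (Fin 4) K, V - V * V = kernelMatrix y ∧ V 3 0 = y * H 0 0 := by
  have hl : ∀ i, H i 0 * y⁻¹ = H i 4 + y⁻¹ := by
    intro i
    have := hlast i
    field_simp
    linear_combination -this
  refine ⟨_, Matrix.sub_mul_self_of_riccati
    (M := Matrix.of fun i j : Fin 4 => H i j)
    (C := !![0, 0, 0, y⁻¹; 1, 0, 0, 0; 0, 1, 0, 0; 0, 0, 1, 0])
    (U := !![1, 0, 0, 0; 0, 0, 0, y; 0, 0, y, 0; 0, y, 0, 0])
    (T := !![0, 0, 0, 0; 0, 1, 0, 0; 0, 1, 1, 0; 0, 1, 1, 1])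
    (E := Matrix.of fun _ j => if j = 3 then y⁻¹ else 0) ?_ ?_ ?_, ?_⟩
  · ext i j
    have hTM : ((!![0, 0, 0, 0; 0, 1, 0, 0; 0, 1, 1, 0; 0, 1, 1, 1] : Matrix (Fin 4) (Fin 4) K) *
        Matrix.of fun i j : Fin 4 => H i j) i j = ∑ m ∈ Finset.range i, H (i - m) j := by
      fin_cases i <;> simp [Matrix.mul_apply, Fin.sum_univ_four, Finset.sum_range_succ] <;> ring
    rw [Matrix.add_apply, Matrix.add_apply, hTM]
    have h := hrec i j
    fin_cases j <;> simp [Matrix.mul_apply, Fin.sum_univ_four, hl] at h ⊢ <;>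
      linear_combination h
  · exact one_sub_kernelMatrix_mul y hy
  · exact one_sub_kernelMatrix_mul_add y hy
  · rw [Matrix.add_apply, Matrix.mul_apply, Fin.sum_univ_four]
    simp [kernelMatrix, Matrix.vecHead]

/-- The matrix is the `B` with `D²(1 - 4W) = s B` for `s = y(5y - 256)(4y + 1)`. In the constant
term, `1 - 80y` is `det(1 - 4W)`, and the other factor is a square. -/
theorem det_smul_one_sub_smul (y s t : K) :
    (t • (1 : Matrix (Fin 4) (Fin 4) K) - s •
      !![-67*y - 115*y^2, -71*y - 20*y^2, -16 - 104*y + 20*y^2, 72 + 330*y;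
        72*y + 330*y^2, -11*y + 40*y^2, -31*y - 40*y^2, -16 - 64*y;
        -16*y - 104*y^2 + 20*y^3, 56*y + 155*y^2, -27*y - 135*y^2, -31*y - 40*y^2;
        -71*y^2 - 20*y^3, -16*y - 175*y^2, 56*y + 155*y^2, -11*y + 40*y^2]).det =
      t ^ 4 - s * (-116*y - 170*y^2) * t ^ 3
        + s ^ 2 * (-512*y + 10542*y^2 + 51704*y^3 + 26885*y^4 - 400*y^5) * t ^ 2
        - s ^ 3 * (-232448*y^2 - 4333892*y^3 - 22663425*y^4 - 36010100*y^5 + 712000*y^6) * t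
        + s ^ 4 * (y ^ 2 * ((5 * y - 256) * (4 * y + 1)) ^ 2 * (1 - 80 * y)) := by
  rw [Matrix.det_succ_row_zero]
  simp [Fin.sum_univ_succ, Matrix.det_fin_three, Matrix.submatrix_apply, Fin.succAbove,
    Matrix.one_apply]
  ring


/-- The matrix of multiplication by `y (5 y - 256) (4 y + 1) w ^ 2 / χ'(w)`, where
`χ = w ^ 4 - y w ^ 2 + 3 y w - y`. -/
def diffMatrix (y : K) : Matrix (Fin 4) (Fin 4) K :=
  !![48*y + 45*y^2, 76*y + 10*y^2, 71*y - 10*y^2, -64 - 256*y;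
    -64*y - 256*y^2, -16*y - 64*y^2, 12*y + 48*y^2, 7*y + 28*y^2;
    71*y^2 - 10*y^3, -64*y - 109*y^2, -16*y + 83*y^2, 12*y + 48*y^2;
    76*y^2 + 10*y^3, 147*y^2, -64*y - 109*y^2, -16*y - 64*y^2]

/-- Being a polynomial in `kernelMatrix y`, this matrix commutes with everything that commutes with
`kernelMatrix y`, in particular with `V`. -/
theorem diffMatrix_eq (y : K) : diffMatrix y = (12 * y ^ 2 - 144 * y) • 1 +
    (140 * y - 28 * y ^ 2) • kernelMatrix y + (147 * y) • (kernelMatrix y * kernelMatrix y) +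
    (38 * y - 64) • (kernelMatrix y * kernelMatrix y * kernelMatrix y) := by
  ext i j
  fin_cases i <;> fin_cases j <;>
    simp [kernelMatrix, diffMatrix] <;> ring

theorem trace_diffMatrix (y : K) : (diffMatrix y).trace = 0 := by
  simp [diffMatrix, Matrix.trace, Fin.sum_univ_four]
  ring

set_option maxHeartbeats 1000000 in
/-- The trace pairing with `diffMatrix` on matrices commuting with `kernelMatrix`. -/
theorem trace_diffMatrix_mul (y : K) {V : Matrix (Fin 4) (Fin 4) K}
    (hV : Commute V (kernelMatrix y)) :
    (diffMatrix y * V).trace = (5 * y - 256) * (4 * y + 1) * V 3 0 := by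
  -- Modulo a commutator with `kernelMatrix y`, the matrix is a multiple of the unit that extracts
  -- `V 3 0`. Such commutators have trace zero against any commuting `V`.
  obtain ⟨Y, hY⟩ : ∃ Y : Matrix (Fin 4) (Fin 4) K, diffMatrix y =
      Matrix.single 0 3 ((5 * y - 256) * (4 * y + 1)) +
        (Y * kernelMatrix y - kernelMatrix y * Y) := by
    refine ⟨!![-76*y - 10*y^2, -147*y, 64 + 109*y, 16 + 64*y;
      -160*y - 52*y^2, -296*y - 8*y^2, -290*y + 16*y^2, -128 - 508*y + 16*y^2;
      -64*y + 38*y^2, -144*y + 12*y^2, -148*y - 4*y^2, -y - 4*y^2; 0, 0, 0, 0], ?_⟩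
    ext i j
    fin_cases i <;> fin_cases j <;>
      simp [kernelMatrix, diffMatrix] <;> ring
  have hcyc : (Y * kernelMatrix y * V).trace = (kernelMatrix y * Y * V).trace := by
    rw [mul_assoc, ← hV.eq, ← mul_assoc, Matrix.trace_mul_comm, mul_assoc]
  rw [hY, add_mul, Matrix.trace_add, Matrix.trace_single_mul, sub_mul _ _ V, Matrix.trace_sub, hcyc,
    sub_self, add_zero, smul_eq_mul]

theorem diffMatrix_mul_self (y : K) : diffMatrix y * diffMatrix y * (1 - 4 • kernelMatrix y) =
    (y * ((5 * y - 256) * (4 * y + 1))) •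
      !![-67*y - 115*y^2, -71*y - 20*y^2, -16 - 104*y + 20*y^2, 72 + 330*y;
        72*y + 330*y^2, -11*y + 40*y^2, -31*y - 40*y^2, -16 - 64*y;
        -16*y - 104*y^2 + 20*y^3, 56*y + 155*y^2, -27*y - 135*y^2, -31*y - 40*y^2;
        -71*y^2 - 20*y^3, -16*y - 175*y^2, 56*y + 155*y^2, -11*y + 40*y^2] := by
  ext i j
  fin_cases i <;> fin_cases j <;>
    simp [kernelMatrix, diffMatrix, Matrix.mul_apply, Fin.sum_univ_four, Matrix.one_apply] <;> ring

/-- `X = D(1 - 2V)` has trace `-2 s f` and explicit square, so the trace equation applies with `-2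
f` in place of `f`. -/
theorem scheme_elimination [CharZero K] (y : K) (hy : y ≠ 0) (hD : (5 * y - 256) * (4 * y + 1) ≠ 0)
    (H : ℕ → ℕ → K)
    (hrec : ∀ i j, H i (j + 1) = ∑ m ∈ Finset.range i, H (i - m) j
      + H i 0 * H 0 j + y * (H i 1 * H 3 j + H i 2 * H 2 j + H i 3 * H 1 j))
    (hlast : ∀ i, y * H i 4 = H i 0 - 1) :
    ∑ k ∈ Finset.range 9, (eqCoeff4 k).aeval y * H 0 0 ^ (2 * k) = 0 := by
  obtain ⟨V, hV, hV30⟩ := exists_matrix_of_riccati y hy H hrec hlast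
  have hVW : Commute V (kernelMatrix y) := by
    rw [← hV]
    exact (Commute.refl V).sub_right ((Commute.refl V).mul_right (Commute.refl V))
  have hAV : Commute (diffMatrix y) (1 - 2 • V) := by
    have h2 := hVW.mul_right hVW
    refine (Commute.one_right _).sub_right (Commute.smul_right ?_ 2)
    rw [diffMatrix_eq]
    exact ((((Commute.one_right V).smul_right _).add_right (hVW.smul_right _)).add_right
      (h2.smul_right _)).add_right ((h2.mul_right hVW).smul_right _) |>.symm
  have hS : (1 - 2 • V) * (1 - 2 • V) = 1 - 4 • kernelMatrix y := by
    rw [← hV]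
    noncomm_ring
  set f := H 0 0 with hf
  have key := Matrix.trace_eq_of_mul_self (diffMatrix y * (1 - 2 • V)) _
    (y * ((5 * y - 256) * (4 * y + 1))) _ _ _ _ (mul_ne_zero hy hD)
    (by rw [hAV.symm.mul_mul_mul_comm, hS, diffMatrix_mul_self])
    (det_smul_one_sub_smul y _) (-2 * f) (by
      rw [mul_sub, mul_one, mul_smul_comm, Matrix.trace_sub, trace_diffMatrix, Matrix.trace_smul,
        trace_diffMatrix_mul y hVW, hV30, nsmul_eq_mul]
      push_cast
      ring)
  -- The trace equation is `P` multiplied by this extraneous factor.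
  have hc : (256 : K) * y ^ 5 * ((5 * y - 256) * (4 * y + 1)) ^ 4 ≠ 0 := by
    refine mul_ne_zero (mul_ne_zero (by norm_num) (pow_ne_zero _ hy)) (pow_ne_zero _ hD)
  refine mul_left_cancel₀ hc ?_
  rw [mul_zero, ← sub_eq_zero.2 key]
  simp only [Finset.sum_range_succ, Finset.sum_range_zero, eqCoeff4]
  simp only [map_add, map_sub, map_mul, map_pow, Polynomial.aeval_X, map_ofNat, map_one]
  ring

end

/-! ### A Jacobian criterion for local elimination. -/

theorem MvPolynomial.derivation_eq_sum_pderiv {k σ M : Type*} [CommRing k] [Fintype σ]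
    [AddCommGroup M] [Module k M] [Module (MvPolynomial σ k) M]
    (D : Derivation k (MvPolynomial σ k) M) (f : MvPolynomial σ k) :
    D f = ∑ i, MvPolynomial.pderiv i f • D (MvPolynomial.X i) := by
  classical
  induction f using MvPolynomial.induction_on with
  | C a => simp [MvPolynomial.derivation_C]
  | add p q hp hq => simp [hp, hq, add_smul, Finset.sum_add_distrib]
  | mul_X p n hp =>
    simp only [Derivation.leibniz, hp, MvPolynomial.pderiv_X, smul_eq_mul, add_smul,
      Finset.sum_add_distrib, Finset.smul_sum, mul_smul]
    simp [Pi.single_apply, ite_smul]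

/-- Unramified over a field means finite and reduced, and a reduced Artinian local ring is a field.
-/
theorem Algebra.FormallyUnramified.isField_of_isLocalRing {K B : Type*} [Field K] [CommRing B]
    [Algebra K B] [IsLocalRing B] [Algebra.FormallyUnramified K B] [Algebra.EssFiniteType K B] :
    IsField B := by
  have : IsReduced B := Algebra.FormallyUnramified.isReduced_of_field K B
  have : Module.Finite K B := Algebra.FormallyUnramified.finite_of_free K B
  have : IsArtinianRing B := IsArtinianRing.of_finite K B
  exact IsArtinianRing.isField_of_isReduced_of_isLocalRing B

theorem Algebra.FormallyUnramified.isField_of_isUnit {k B : Type*} [CommRing k] [IsDomain k]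
    [CommRing B] [Algebra k B] [IsLocalRing B] [Algebra.FormallyUnramified k B]
    [Algebra.EssFiniteType k B] (hk : ∀ c : nonZeroDivisors k, IsUnit (algebraMap k B c)) :
    IsField B := by
  let φ : FractionRing k →+* B := IsLocalization.lift hk
  let _ : Algebra (FractionRing k) B := φ.toAlgebra
  have : IsScalarTower k (FractionRing k) B := IsScalarTower.of_algebraMap_eq fun c =>
    (IsLocalization.lift_eq hk c).symm
  have : Algebra.FormallyUnramified (FractionRing k) B :=
    Algebra.FormallyUnramified.of_restrictScalars k _ B
  have : Algebra.EssFiniteType (FractionRing k) B := Algebra.EssFiniteType.of_comp k _ B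
  exact Algebra.FormallyUnramified.isField_of_isLocalRing (K := FractionRing k)

/-- An algebra is formally unramified if it is generated, up to inverses, by the images of
variables satisfying as many polynomial equations with invertible Jacobian determinant. -/
theorem Algebra.FormallyUnramified.of_isUnit_jacobian {k B σ : Type*} [CommRing k] [CommRing B]
    [Algebra k B] [Fintype σ] [DecidableEq σ] (ρ : MvPolynomial σ k →ₐ[k] B)
    (hρ : ∀ b : B, ∃ s p : MvPolynomial σ k, IsUnit (ρ s) ∧ b * ρ s = ρ p)
    (e : σ → MvPolynomial σ k) (he : ∀ i, ρ (e i) = 0)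
    (hJ : IsUnit (ρ (Matrix.of fun i j => MvPolynomial.pderiv j (e i)).det)) :
    Algebra.FormallyUnramified k B := by
  have key : ∀ D : Derivation k B (Ω[B⁄k]), ∀ b, D b = 0 := by
    intro D
    let _ : Module (MvPolynomial σ k) (Ω[B⁄k]) := Module.compHom _ ρ.toRingHom
    have hsm : ∀ (p : MvPolynomial σ k) (m : Ω[B⁄k]), p • m = ρ p • m := fun _ _ => rfl
    let δ : Derivation k (MvPolynomial σ k) (Ω[B⁄k]) :=
      Derivation.mk' ((D : B →ₗ[k] Ω[B⁄k]) ∘ₗ ρ.toLinearMap) fun a b => by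
        simp [hsm]
    have hδ : ∀ p, δ p = D (ρ p) := fun _ => rfl
    rw [AlgHom.map_det] at hJ
    set J := ρ.mapMatrix (Matrix.of fun i j => MvPolynomial.pderiv j (e i))
    have h1 : ∀ i, ∑ j, J i j • δ (MvPolynomial.X j) = 0 := fun i => by
      have := MvPolynomial.derivation_eq_sum_pderiv δ (e i)
      rw [hδ, he, map_zero] at this
      exact this.symm
    have h2 : ∀ j, δ (MvPolynomial.X j) = 0 := fun j => by
      -- Cramer's rule: the adjugate turns the system `h1` into `det J • δ (X j) = 0`.
      have h3 : ∑ i, J.adjugate j i • ∑ l, J i l • δ (MvPolynomial.X l) = 0 := by simp [h1]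
      simp only [Finset.smul_sum, smul_smul] at h3
      rw [Finset.sum_comm] at h3
      simp only [← Finset.sum_smul, ← Matrix.mul_apply, Matrix.adjugate_mul, Matrix.smul_apply,
        Matrix.one_apply, smul_eq_mul, mul_ite, mul_one, mul_zero, ite_smul, zero_smul,
        Finset.sum_ite_eq, Finset.mem_univ, if_true] at h3
      exact (hJ.smul_eq_zero).1 h3
    have h4 : ∀ p, D (ρ p) = 0 := fun p => by
      rw [← hδ, MvPolynomial.derivation_eq_sum_pderiv δ p]
      simp [h2]
    intro b
    obtain ⟨s, p, hs, hb⟩ := hρ b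
    have := h4 p
    rw [← hb, D.leibniz, h4 s, smul_zero, zero_add] at this
    exact hs.smul_eq_zero.1 this
  refine ⟨?_⟩
  rw [← Submodule.subsingleton_iff B, ← subsingleton_iff_bot_eq_top,
    ← KaehlerDifferential.span_range_derivation, eq_comm, Submodule.span_eq_bot]
  rintro _ ⟨b, rfl⟩
  exact key _ b

/-- If `g` is a common zero, in an extension domain `L` of `k`, of as many polynomials as there are
variables, and the Jacobian determinant does not vanish at `g`, then every polynomial vanishing at
`g` lies locally at `g` in the ideal generated by the given polynomials. -/
theorem MvPolynomial.exists_mul_mem_span_of_jacobian {k L σ : Type*} [CommRing k] [IsDomain k]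
    [CommRing L] [IsDomain L] [Algebra k L] [FaithfulSMul k L] [Fintype σ] [DecidableEq σ]
    (g : σ → L) (e : σ → MvPolynomial σ k) (he : ∀ i, aeval g (e i) = 0)
    (hJ : (Matrix.of fun i j => aeval g (pderiv j (e i))).det ≠ 0)
    {q : MvPolynomial σ k} (hq : aeval g q = 0) :
    ∃ h : MvPolynomial σ k, aeval g h ≠ 0 ∧ h * q ∈ Ideal.span (Set.range e) := by
  set I := Ideal.span (Set.range e) with hI
  let A := MvPolynomial σ k ⧸ I
  have hIker : ∀ a ∈ I, aeval g a = 0 := by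
    intro a ha
    have : I ≤ RingHom.ker (aeval (R := k) g) := by
      rw [hI, Ideal.span_le]
      rintro _ ⟨i, rfl⟩
      exact he i
    exact this ha
  let ψ : A →ₐ[k] L := Ideal.Quotient.liftₐ I (aeval g) hIker
  let P : Ideal A := RingHom.ker ψ
  have hPp : P.IsPrime := RingHom.ker_isPrime ψ
  let B := Localization.AtPrime P
  let ρ : MvPolynomial σ k →ₐ[k] B := (IsScalarTower.toAlgHom k A B).comp (Ideal.Quotient.mkₐ k I)
  have hρ : ∀ r, ρ r = algebraMap A B (Ideal.Quotient.mk I r) := fun r => rfl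
  have hunit : ∀ r : MvPolynomial σ k, aeval g r ≠ 0 → IsUnit (ρ r) :=
    fun r hr => IsLocalization.map_units B (⟨Ideal.Quotient.mk I r, hr⟩ : P.primeCompl)
  have hunr : Algebra.FormallyUnramified k B := by
    refine Algebra.FormallyUnramified.of_isUnit_jacobian ρ (fun b => ?_) e (fun i => ?_) ?_
    · obtain ⟨⟨a, s⟩, h⟩ := IsLocalization.surj P.primeCompl b
      obtain ⟨p, rfl⟩ := Ideal.Quotient.mk_surjective a
      obtain ⟨s, hs⟩ := s
      obtain ⟨s, rfl⟩ := Ideal.Quotient.mk_surjective s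
      exact ⟨s, p, hunit s hs, h⟩
    · rw [hρ, Ideal.Quotient.eq_zero_iff_mem.2 (Ideal.subset_span (Set.mem_range_self i)),
        map_zero]
    · refine hunit _ ?_
      rw [AlgHom.map_det]
      exact hJ
  have hB : IsField B := Algebra.FormallyUnramified.isField_of_isUnit (k := k) (B := B) fun c => by
    have := hunit (C c) (by
      rw [aeval_C]
      exact (map_ne_zero_iff _ (FaithfulSMul.algebraMap_injective k L)).2
        (nonZeroDivisors.ne_zero c.2))
    exact (AlgHom.commutes ρ (c : k)) ▸ this
  -- The image of `q` lies in the maximal ideal, which is zero. Clearing the denominator of the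
  -- localization produces `h`.
  have hzero : algebraMap A B (Ideal.Quotient.mk I q) = 0 := by
    have hm : algebraMap A B (Ideal.Quotient.mk I q) ∈ IsLocalRing.maximalIdeal B :=
      (IsLocalization.AtPrime.to_map_mem_maximal_iff B P _).2 hq
    rwa [IsLocalRing.isField_iff_maximalIdeal_eq.1 hB] at hm
  obtain ⟨⟨s, hs⟩, hs'⟩ := (IsLocalization.map_eq_zero_iff P.primeCompl B _).1 hzero
  obtain ⟨h, rfl⟩ := Ideal.Quotient.mk_surjective s
  refine ⟨h, hs, ?_⟩
  rw [← Ideal.Quotient.eq_zero_iff_mem, map_mul]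
  exact hs'

/-! ### Irreducibility of `P`. -/

/-- The `a`'s and `b`'s are coefficients of a monic factor and its cofactor. Each equation stands
directly after the variables it constrains, so that the exhaustive search is pruned at once. -/
theorem zmod3_no_factor_one : ∀ b7 : ZMod 3, b7 = 1 → ∀ a0 b6 : ZMod 3, a0 * b7 + b6 = 1 →
    ∀ b5, a0 * b6 + b5 = 0 → ∀ b4, a0 * b5 + b4 = 0 → ∀ b3, a0 * b4 + b3 = 0 →
    ∀ b2, a0 * b3 + b2 = 1 → ∀ b1, a0 * b2 + b1 = 0 → ∀ b0, a0 * b1 + b0 = 1 →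
    a0 * b0 = 1 → False := by
  decide

set_option synthInstance.maxHeartbeats 400000 in
set_option synthInstance.maxSize 2000 in
theorem zmod3_no_factor_two : ∀ b6 : ZMod 3, b6 = 1 → ∀ a1 b5 : ZMod 3, a1 * b6 + b5 = 1 →
    ∀ a0 b4 : ZMod 3, a0 * b6 + a1 * b5 + b4 = 0 → ∀ b3, a0 * b5 + a1 * b4 + b3 = 0 →
    ∀ b2, a0 * b4 + a1 * b3 + b2 = 0 → ∀ b1, a0 * b3 + a1 * b2 + b1 = 1 →
    ∀ b0, a0 * b2 + a1 * b1 + b0 = 0 → a0 * b1 + a1 * b0 = 1 → a0 * b0 = 1 → False := by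
  decide +kernel

set_option synthInstance.maxHeartbeats 400000 in
set_option synthInstance.maxSize 2000 in
theorem zmod3_no_factor_three : ∀ b5 : ZMod 3, b5 = 1 → ∀ a2 b4 : ZMod 3, a2 * b5 + b4 = 1 →
    ∀ a1 b3 : ZMod 3, a1 * b5 + a2 * b4 + b3 = 0 →
    ∀ a0 b2 : ZMod 3, a0 * b5 + a1 * b4 + a2 * b3 + b2 = 0 →
    ∀ b1, a0 * b4 + a1 * b3 + a2 * b2 + b1 = 0 → ∀ b0, a0 * b3 + a1 * b2 + a2 * b1 + b0 = 1 →
    a0 * b2 + a1 * b1 + a2 * b0 = 0 → a0 * b1 + a1 * b0 = 1 → a0 * b0 = 1 → False := by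
  decide +kernel

set_option synthInstance.maxHeartbeats 400000 in
set_option synthInstance.maxSize 2000 in
theorem zmod7_no_factor_four : ∀ b4 : ZMod 7, b4 = 3 → ∀ a3 b3 : ZMod 7, a3 * b4 + b3 = 6 →
    ∀ a2 b2 : ZMod 7, a2 * b4 + a3 * b3 + b2 = 3 →
    ∀ a1 b1 : ZMod 7, a1 * b4 + a2 * b3 + a3 * b2 + b1 = 4 →
    ∀ a0 b0 : ZMod 7, a0 * b4 + a1 * b3 + a2 * b2 + a3 * b1 + b0 = 5 →
    a0 * b3 + a1 * b2 + a2 * b1 + a3 * b0 = 0 → a0 * b2 + a1 * b1 + a2 * b0 = 5 →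
    a0 * b1 + a1 * b0 = 1 → a0 * b0 = 5 → False := by
  decide +kernel

/-- The polynomial of degree `8` in `F ^ 2` underlying `eqPoly4`. -/
noncomputable def eqPolySq : ℤ[X][X] :=
  ∑ k ∈ Finset.range 9, Polynomial.C (eqCoeff4 k) * Polynomial.X ^ k

theorem eqPoly4_eq_expand : eqPoly4 = Polynomial.expand ℤ[X] 2 eqPolySq := by
  simp only [eqPoly4, eqPolySq, map_sum, map_mul, map_pow, Polynomial.expand_C,
    Polynomial.expand_X, pow_mul]

theorem coeff_eqPolySq (k : ℕ) : eqPolySq.coeff k = eqCoeff4 k := by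
  simp only [eqPolySq, Polynomial.finsetSum_coeff, Polynomial.coeff_C_mul_X_pow,
    Finset.sum_ite_eq, Finset.mem_range]
  split_ifs with h
  · rfl
  · match k, h with
    | k + 9, _ => rfl
    | 0, h | 1, h | 2, h | 3, h | 4, h | 5, h | 6, h | 7, h | 8, h => exact absurd h (by norm_num)

theorem eqCoeff4_eight_ne_zero : eqCoeff4 8 ≠ 0 := by
  intro h
  have := congrArg (Polynomial.eval 1) h
  norm_num [eqCoeff4] at this

theorem natDegree_eqPolySq : eqPolySq.natDegree = 8 := by
  refine Polynomial.natDegree_eq_of_le_of_coeff_ne_zero ?_ ?_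
  · refine Polynomial.natDegree_le_iff_coeff_eq_zero.2 fun k hk => ?_
    rw [coeff_eqPolySq]
    match k, hk with
    | k + 9, _ => rfl
  · rw [coeff_eqPolySq]; exact eqCoeff4_eight_ne_zero

/-- Reduction modulo `p` at `x = c`. -/
noncomputable def specialize (p : ℕ) (c : ZMod p) : ℤ[X] →+* ZMod p :=
  Polynomial.eval₂RingHom (Int.castRingHom (ZMod p)) c

theorem Polynomial.exists_monic_mul_eq {F : Type*} [Field F] {A B R : F[X]} (h : A * B = R)
    (hR : R ≠ 0) : ∃ A' B' : F[X], A' * B' = R ∧ A'.Monic ∧ A'.natDegree = A.natDegree ∧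
      B'.natDegree = B.natDegree := by
  have hA : A.leadingCoeff ≠ 0 := by
    rintro h0
    rw [Polynomial.leadingCoeff_eq_zero] at h0
    exact hR (by rw [← h, h0, zero_mul])
  refine ⟨A * C A.leadingCoeff⁻¹, C A.leadingCoeff * B, ?_, ?_, ?_, ?_⟩
  · rw [mul_assoc, ← mul_assoc (C _), ← C_mul, inv_mul_cancel₀ hA, C_1, one_mul, h]
  · exact monic_mul_leadingCoeff_inv (by simpa using hA)
  · exact natDegree_mul_C (inv_ne_zero hA)
  · exact natDegree_C_mul hA

/-- The specialized leading coefficient is nonzero, so neither factor can drop in degree; rescaling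
over the field makes the first one monic. -/
theorem specialize_factor {A B : ℤ[X][X]} (h : A * B = eqPolySq) {p : ℕ} [Fact p.Prime]
    (c : ZMod p) (hc : specialize p c (eqCoeff4 8) ≠ 0) :
    ∃ A' B' : (ZMod p)[X], A'.Monic ∧ A'.natDegree = A.natDegree ∧ B'.natDegree = B.natDegree ∧
      ∀ k, ∑ i ∈ Finset.range (k + 1), A'.coeff i * B'.coeff (k - i) =
        specialize p c (eqCoeff4 k) := by
  set φ := specialize p c
  have hmap : A.map φ * B.map φ = eqPolySq.map φ := by rw [← Polynomial.map_mul, h]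
  have h8 : (eqPolySq.map φ).natDegree = 8 := by
    rw [Polynomial.natDegree_map_of_leadingCoeff_ne_zero, natDegree_eqPolySq]
    rwa [Polynomial.leadingCoeff, natDegree_eqPolySq, coeff_eqPolySq]
  have hne : eqPolySq.map φ ≠ 0 := by
    intro h0
    rw [h0] at h8
    simp at h8
  have hsum : A.natDegree + B.natDegree = 8 := by
    rw [← natDegree_eqPolySq, ← h, Polynomial.natDegree_mul]
    · rintro rfl
      simp [← h] at hne
    · rintro rfl
      simp [← h] at hne
  have hsum' : (A.map φ).natDegree + (B.map φ).natDegree = 8 := by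
    rw [← h8, ← hmap, Polynomial.natDegree_mul]
    · exact fun h0 => hne (by rw [← hmap, h0, zero_mul])
    · exact fun h0 => hne (by rw [← hmap, h0, mul_zero])
  have hA := Polynomial.natDegree_map_le (p := A) (f := φ)
  have hB := Polynomial.natDegree_map_le (p := B) (f := φ)
  obtain ⟨A', B', hAB, hmon, hdA, hdB⟩ := Polynomial.exists_monic_mul_eq hmap hne
  refine ⟨A', B', hmon, by omega, by omega, fun k => ?_⟩
  rw [← Finset.Nat.sum_antidiagonal_eq_sum_range_succ fun i j => A'.coeff i * B'.coeff j,
    ← Polynomial.coeff_mul, hAB, Polynomial.coeff_map, coeff_eqPolySq]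

theorem specialize_eqCoeff4_three (k : ℕ) (hk : k < 9) : specialize 3 1 (eqCoeff4 k) =
    ![(1 : ZMod 3), 1, 0, 1, 0, 0, 0, 1, 1] ⟨k, hk⟩ := by
  interval_cases k <;>
    simp only [specialize, eqCoeff4, map_add, map_sub, map_mul, map_pow, map_ofNat, map_one,
      Polynomial.coe_eval₂RingHom, Polynomial.eval₂_X] <;> rfl

theorem specialize_eqCoeff4_seven (k : ℕ) (hk : k < 9) : specialize 7 3 (eqCoeff4 k) =
    ![(5 : ZMod 7), 1, 5, 0, 5, 4, 3, 6, 3] ⟨k, hk⟩ := by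
  interval_cases k <;>
    simp only [specialize, eqCoeff4, map_add, map_sub, map_mul, map_pow, map_ofNat, map_one,
      Polynomial.coe_eval₂RingHom, Polynomial.eval₂_X] <;> rfl

/-- Degrees 1, 2, 3 are excluded modulo 3 at `x = 1`, and degree 4 modulo 7 at `x = 3`. Applied to
both factors, whose degrees add up to 8, this leaves only constant factors. -/
theorem natDegree_factor_eqPolySq {A B : ℤ[X][X]} (h : A * B = eqPolySq) :
    A.natDegree = 0 ∨ 5 ≤ A.natDegree := by
  by_contra! hcon
  obtain ⟨h0, h5⟩ := hcon
  have hA0 : A ≠ 0 := by rintro rfl; simp at h0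
  have hB0 : B ≠ 0 := by
    rintro rfl
    have := natDegree_eqPolySq
    simp [← h] at this
  have hsum : A.natDegree + B.natDegree = 8 := by
    rw [← natDegree_eqPolySq, ← h, Polynomial.natDegree_mul hA0 hB0]
  have hne3 : (1 : ZMod 3) ≠ 0 := by decide
  have hne7 : (3 : ZMod 7) ≠ 0 := by decide
  have : Fact (Nat.Prime 3) := ⟨by norm_num⟩
  have : Fact (Nat.Prime 7) := ⟨by norm_num⟩
  obtain ⟨A', B', hmon, hdA, hdB, hco⟩ := specialize_factor h (p := 3) 1 (by
    rw [specialize_eqCoeff4_three 8 (by norm_num)]; exact hne3)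
  obtain ⟨A₂, B₂, hmon₂, hdA₂, hdB₂, hco₂⟩ := specialize_factor h (p := 7) 3 (by
    rw [specialize_eqCoeff4_seven 8 (by norm_num)]; exact hne7)
  have hA' : ∀ k, A.natDegree < k → A'.coeff k = 0 := fun k hk =>
    Polynomial.coeff_eq_zero_of_natDegree_lt (by omega)
  have hB' : ∀ k, B.natDegree < k → B'.coeff k = 0 := fun k hk =>
    Polynomial.coeff_eq_zero_of_natDegree_lt (by omega)
  have hA₂ : ∀ k, A.natDegree < k → A₂.coeff k = 0 := fun k hk =>
    Polynomial.coeff_eq_zero_of_natDegree_lt (by omega)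
  have hB₂ : ∀ k, B.natDegree < k → B₂.coeff k = 0 := fun k hk =>
    Polynomial.coeff_eq_zero_of_natDegree_lt (by omega)
  have hl := hmon.coeff_natDegree
  have hl₂ := hmon₂.coeff_natDegree
  rw [hdA] at hl
  rw [hdA₂] at hl₂
  have e := fun k hk => (hco k).trans (specialize_eqCoeff4_three k hk)
  have e₂ := fun k hk => (hco₂ k).trans (specialize_eqCoeff4_seven k hk)
  obtain hd | hd | hd | hd : A.natDegree = 1 ∨ A.natDegree = 2 ∨ A.natDegree = 3 ∨
    A.natDegree = 4 := by omega
  · have hB : B.natDegree = 7 := by omega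
    rw [hd] at hA' hA₂ hl hl₂
    rw [hB] at hB' hB₂
    have h8 := e 8 (by norm_num)
    have h7 := e 7 (by norm_num)
    have h6 := e 6 (by norm_num)
    have h5 := e 5 (by norm_num)
    have h4 := e 4 (by norm_num)
    have h3 := e 3 (by norm_num)
    have h2 := e 2 (by norm_num)
    have h1 := e 1 (by norm_num)
    have h0 := e 0 (by norm_num)
    simp [Finset.sum_range_succ, hA', hB', hl] at h0 h1 h2 h3 h4 h5 h6 h7 h8
    exact zmod3_no_factor_one _ h8 _ _ h7 _ h6 _ h5 _ h4 _ h3 _ h2 _ h1 h0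
  · have hB : B.natDegree = 6 := by omega
    rw [hd] at hA' hA₂ hl hl₂
    rw [hB] at hB' hB₂
    have h8 := e 8 (by norm_num)
    have h7 := e 7 (by norm_num)
    have h6 := e 6 (by norm_num)
    have h5 := e 5 (by norm_num)
    have h4 := e 4 (by norm_num)
    have h3 := e 3 (by norm_num)
    have h2 := e 2 (by norm_num)
    have h1 := e 1 (by norm_num)
    have h0 := e 0 (by norm_num)
    simp [Finset.sum_range_succ, hA', hB', hl] at h0 h1 h2 h3 h4 h5 h6 h7 h8
    exact zmod3_no_factor_two _ h8 _ _ h7 _ _ h6 _ h5 _ h4 _ h3 _ h2 h1 h0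
  · have hB : B.natDegree = 5 := by omega
    rw [hd] at hA' hA₂ hl hl₂
    rw [hB] at hB' hB₂
    have h8 := e 8 (by norm_num)
    have h7 := e 7 (by norm_num)
    have h6 := e 6 (by norm_num)
    have h5 := e 5 (by norm_num)
    have h4 := e 4 (by norm_num)
    have h3 := e 3 (by norm_num)
    have h2 := e 2 (by norm_num)
    have h1 := e 1 (by norm_num)
    have h0 := e 0 (by norm_num)
    simp [Finset.sum_range_succ, hA', hB', hl] at h0 h1 h2 h3 h4 h5 h6 h7 h8
    exact zmod3_no_factor_three _ h8 _ _ h7 _ _ h6 _ _ h5 _ h4 _ h3 h2 h1 h0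
  · have hB : B.natDegree = 4 := by omega
    rw [hd] at hA' hA₂ hl hl₂
    rw [hB] at hB' hB₂
    have h8 := e₂ 8 (by norm_num)
    have h7 := e₂ 7 (by norm_num)
    have h6 := e₂ 6 (by norm_num)
    have h5 := e₂ 5 (by norm_num)
    have h4 := e₂ 4 (by norm_num)
    have h3 := e₂ 3 (by norm_num)
    have h2 := e₂ 2 (by norm_num)
    have h1 := e₂ 1 (by norm_num)
    have h0 := e₂ 0 (by norm_num)
    simp [Finset.sum_range_succ, hA₂, hB₂, hl₂] at h0 h1 h2 h3 h4 h5 h6 h7 h8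
    exact zmod7_no_factor_four _ h8 _ _ h7 _ _ h6 _ _ h5 _ _ h4 h3 h2 h1 h0

theorem isPrimitive_eqPolySq : eqPolySq.IsPrimitive := by
  intro r hr
  rw [Polynomial.C_dvd_iff_dvd_coeff] at hr
  have hr' := fun k => coeff_eqPolySq k ▸ hr k
  -- A nonconstant common divisor would have a complex root. The leading coefficient allows only
  -- three candidates, and coefficients 0 and 1 exclude them.
  have hdeg : r.natDegree = 0 := by
    by_contra h0
    obtain ⟨z, hz⟩ := IsAlgClosed.exists_aeval_eq_zero ℂ r (by
      intro h
      exact h0 (Polynomial.natDegree_eq_of_degree_eq_some h))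
    have key : ∀ k, (eqCoeff4 k).aeval z = 0 := by
      intro k
      obtain ⟨q, hq⟩ := hr' k
      rw [hq, map_mul, hz, zero_mul]
    have k0 := key 0
    have k1 := key 1
    have k8 := key 8
    simp only [eqCoeff4, map_add, map_sub, map_mul, map_pow, map_ofNat, map_one,
      Polynomial.aeval_X, mul_eq_zero, pow_eq_zero_iff, ne_eq, OfNat.ofNat_ne_zero,
      not_false_eq_true] at k0 k1 k8
    have hz0 : z = 0 ∨ z = 256 / 5 ∨ z = -1 / 4 := by
      rcases k8 with (h | h) | h
      · exact Or.inl h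
      · exact Or.inr (Or.inl (by linear_combination h / 5))
      · exact Or.inr (Or.inr (by linear_combination h / 4))
    rcases hz0 with rfl | rfl | rfl
    · norm_num at k1
    · norm_num at k0
    · norm_num at k0
  obtain ⟨m, rfl⟩ : ∃ m, r = Polynomial.C m := ⟨_, Polynomial.eq_C_of_natDegree_eq_zero hdeg⟩
  have heval : ∀ a : ℤ, m ∣ (eqCoeff4 1).eval a := by
    intro a
    obtain ⟨q, hq⟩ := hr' 1
    exact ⟨q.eval a, by rw [hq, Polynomial.eval_mul, Polynomial.eval_C]⟩
  have h0 := heval 0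
  have h1 := heval 1
  norm_num [eqCoeff4] at h0 h1
  exact Polynomial.isUnit_C.2
    ((Int.isCoprime_iff_gcd_eq_one.2 (by norm_num)).isUnit_of_dvd' h0 h1)

theorem irreducible_eqPolySq : Irreducible eqPolySq := by
  have h8 := natDegree_eqPolySq
  have hne : eqPolySq ≠ 0 := by
    intro h
    simp [h] at h8
  refine ⟨fun h => ?_, fun A B hAB => ?_⟩
  · rw [Polynomial.natDegree_eq_zero_of_isUnit h] at h8
    exact absurd h8 (by norm_num)
  · have hunit : ∀ A B : ℤ[X][X], A * B = eqPolySq → A.natDegree = 0 → IsUnit A := by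
      intro A B h hA
      obtain ⟨c, rfl⟩ : ∃ c, A = Polynomial.C c := ⟨_, Polynomial.eq_C_of_natDegree_eq_zero hA⟩
      exact (isPrimitive_eqPolySq c (Dvd.intro B h)).map Polynomial.C
    have hA0 : A ≠ 0 := by rintro rfl; simp at hAB; exact hne hAB
    have hB0 : B ≠ 0 := by rintro rfl; simp at hAB; exact hne hAB
    have hsum : A.natDegree + B.natDegree = 8 := by
      rw [← h8, hAB, Polynomial.natDegree_mul hA0 hB0]
    have hBA : B * A = eqPolySq := by rw [mul_comm, hAB]
    rcases natDegree_factor_eqPolySq hAB.symm with h | h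
    · exact Or.inl (hunit A B hAB.symm h)
    · rcases natDegree_factor_eqPolySq hBA with h' | h'
      · exact Or.inr (hunit B A hBA h')
      · omega

theorem Polynomial.coeff_comp_neg_X {R : Type*} [CommRing R] (A : R[X]) (n : ℕ) :
    (A.comp (-X)).coeff n = (-1) ^ n * A.coeff n := by
  have h : (-X : R[X]) = C (-1) * X := by simp
  rw [h, comp_C_mul_X_coeff, mul_comm]

theorem Polynomial.exists_expand_two_of_comp_neg {R : Type*} [CommRing R] [IsDomain R] [CharZero R]
    {A : R[X]} (h : A.comp (-X) = A) : ∃ A' : R[X], A = expand R 2 A' := by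
  refine ⟨contract 2 A, ?_⟩
  ext n
  rw [coeff_expand (by norm_num), coeff_contract (by norm_num)]
  split_ifs with hn
  · rw [Nat.div_mul_cancel hn]
  · have h1 := congrArg (fun q => coeff q n) h
    simp only [coeff_comp_neg_X] at h1
    rw [Odd.neg_one_pow (Nat.not_even_iff_odd.1 fun h => hn h.two_dvd)] at h1
    have h2 : (2 : R) * A.coeff n = 0 := by linear_combination -h1
    exact (mul_eq_zero.1 h2).resolve_left two_ne_zero

/-- If `p` is irreducible and its constant term is not a unit times a square, then `p(X ^ 2)` is
irreducible. -/
theorem Polynomial.irreducible_expand_two {R : Type*} [CommRing R] [IsDomain R] [CharZero R]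
    [UniqueFactorizationMonoid R] {p : R[X]} (hp : Irreducible p)
    (hsq : ∀ (ε a : R), IsUnit ε → p.coeff 0 ≠ ε * a ^ 2) : Irreducible (expand R 2 p) := by
  set P := expand R 2 p with hP
  have hinj : Function.Injective (expand R 2) := expand_injective (by norm_num)
  have hP0 : P ≠ 0 := fun h => hp.ne_zero (hinj (by rw [← hP, h, map_zero]))
  have hPu : ¬ IsUnit P := by
    intro h
    obtain ⟨c, hc, hc'⟩ := isUnit_iff.1 h
    refine hp.not_isUnit (isUnit_iff.2 ⟨c, hc, hinj ?_⟩)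
    rw [expand_C, hc']
  have hPinv : P.comp (-X) = P := by
    rw [hP, expand_eq_comp_X_pow, comp_assoc]
    simp
  have hcoeff : P.coeff 0 = p.coeff 0 := by
    have := coeff_expand_mul (R := R) (p := 2) (by norm_num) p 0
    rwa [zero_mul] at this
  have hcinv : ∀ A C : R[X], A ≠ 0 → A.comp (-X) = A → P = A * C → C.comp (-X) = C := by
    intro A C hA hAi h
    have h1 := congrArg (fun q => comp q (-X)) h
    simp only [mul_comp, hPinv, hAi] at h1
    exact (mul_left_cancel₀ hA (h.symm.trans h1)).symm
  -- an even factor is a unit or everything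
  have heven : ∀ A C : R[X], ¬ IsUnit A → A ≠ 0 → A.comp (-X) = A → P = A * C → IsUnit C := by
    intro A C hAu hA hAi h
    obtain ⟨C', hC'⟩ := exists_expand_two_of_comp_neg (hcinv A C hA hAi h)
    obtain ⟨A', hA'⟩ := exists_expand_two_of_comp_neg hAi
    have hpe : p = A' * C' := hinj (by rw [map_mul, ← hA', ← hC', ← h])
    rcases hp.isUnit_or_isUnit hpe with hu | hu
    · exact absurd (hA' ▸ hu.map (expand R 2)) hAu
    · exact hC' ▸ hu.map (expand R 2)
  obtain ⟨A, hA, hAP⟩ := WfDvdMonoid.exists_irreducible_factor hPu hP0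
  have hcc : ∀ q : R[X], (q.comp (-X)).comp (-X) = q := by
    intro q
    rw [comp_assoc]
    simp
  have hA' : A.comp (-X) ∣ P := by
    obtain ⟨C, hC⟩ := hAP
    exact ⟨C.comp (-X), by rw [← mul_comp, ← hC, hPinv]⟩
  -- If `A` is associated to its reflection, it is even or odd: even makes the cofactor a unit, odd
  -- makes the constant term zero. Otherwise `A(X) A(-X)` is an even divisor, so the constant term
  -- is a unit times a square.
  by_cases hdvd : A ∣ A.comp (-X)
  · obtain ⟨u, hu⟩ := hdvd
    have hu0 : u ≠ 0 := by
      rintro rfl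
      rw [mul_zero] at hu
      have := hcc A
      rw [hu, zero_comp] at this
      exact hA.ne_zero this.symm
    have hud : u.natDegree = 0 := by
      have h1 := congrArg natDegree hu
      rw [natDegree_mul hA.ne_zero hu0, natDegree_comp, natDegree_neg, natDegree_X, mul_one] at h1
      omega
    obtain ⟨c, rfl⟩ : ∃ c, u = C c := ⟨_, eq_C_of_natDegree_eq_zero hud⟩
    have hc2 : c * c = 1 := by
      have h1 := congrArg (fun q => comp q (-X)) hu
      simp only [hcc, mul_comp, C_comp] at h1
      rw [hu, mul_assoc, ← C_mul] at h1
      have h2 : A * C (c * c) = A * 1 := by rw [← h1, mul_one]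
      have h3 := mul_left_cancel₀ hA.ne_zero h2
      rwa [← C_1, C_inj] at h3
    rcases mul_self_eq_one_iff.1 hc2 with rfl | rfl
    · obtain ⟨D, hD⟩ := hAP
      rw [C_1, mul_one] at hu
      have hDu := heven A D hA.not_isUnit hA.ne_zero hu hD
      rw [hD]
      exact (irreducible_mul_isUnit hDu).2 hA
    · exfalso
      obtain ⟨D, hD⟩ := hAP
      have h1 := congrArg (fun q => coeff q 0) hu
      simp only [coeff_comp_neg_X, pow_zero, one_mul, mul_coeff_zero, coeff_C_zero] at h1
      have h2 : (2 : R) * A.coeff 0 = 0 := by linear_combination h1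
      have h3 := (mul_eq_zero.1 h2).resolve_left two_ne_zero
      refine hsq 1 0 isUnit_one ?_
      rw [← hcoeff, hD, mul_coeff_zero, h3]
      ring
  · exfalso
    obtain ⟨D, hD⟩ := hA'
    obtain ⟨E, rfl⟩ := (hA.prime.dvd_or_dvd (hD ▸ hAP)).resolve_left hdvd
    have hN : P = (A * A.comp (-X)) * E := by rw [hD]; ring
    have hA0 : A.comp (-X) ≠ 0 := fun h => hA.ne_zero (by rw [← hcc A, h, zero_comp])
    have hEu := heven (A * A.comp (-X)) E (fun h => hA.not_isUnit (isUnit_of_mul_isUnit_left h))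
      (mul_ne_zero hA.ne_zero hA0) (by rw [mul_comp, hcc, mul_comm]) hN
    obtain ⟨ε, hε, rfl⟩ := isUnit_iff.1 hEu
    refine hsq ε (A.coeff 0) hε ?_
    rw [← hcoeff, hN]
    simp only [mul_coeff_zero, coeff_comp_neg_X, coeff_C_zero, pow_zero, one_mul]
    ring

/-- The constant coefficient has degree 7 in `x`, and a unit times a square has even degree. -/
theorem irreducible_eqPoly4 : Irreducible eqPoly4 := by
  rw [eqPoly4_eq_expand]
  refine Polynomial.irreducible_expand_two irreducible_eqPolySq fun ε a hε h => ?_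
  rw [coeff_eqPolySq] at h
  have h7 : (eqCoeff4 0).natDegree = 7 := by
    simp only [eqCoeff4]
    compute_degree!
  have ha : a ≠ 0 := by
    rintro rfl
    simp [h] at h7
  rw [h, Polynomial.natDegree_mul hε.ne_zero (pow_ne_zero 2 ha), Polynomial.natDegree_pow,
    Polynomial.natDegree_eq_zero_of_isUnit hε] at h7
  omega

theorem natDegree_eqPoly4 : eqPoly4.natDegree = 16 := by
  rw [eqPoly4_eq_expand, Polynomial.natDegree_expand, natDegree_eqPolySq]

theorem leadingCoeff_eqPoly4 : eqPoly4.leadingCoeff = eqCoeff4 8 := by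
  rw [eqPoly4_eq_expand, Polynomial.leadingCoeff_expand (by norm_num), Polynomial.leadingCoeff,
    natDegree_eqPolySq, coeff_eqPolySq]

/-! ### Minimal equations and the substitution of `x ^ 4` for `x`. -/

/-- By Gauss's lemma `p` stays irreducible over the fraction field, where it is the minimal
polynomial of `s` up to a scalar; primitivity brings the divisibility back to `R`. -/
theorem Irreducible.dvd_of_aeval_eq_zero {R S : Type*} [CommRing R] [IsDomain R]
    [NormalizedGCDMonoid R] [CommRing S] [IsDomain S] [Algebra R S] [FaithfulSMul R S]
    {p q : R[X]} (hp : Irreducible p) (hdeg : p.natDegree ≠ 0) {s : S}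
    (hps : Polynomial.aeval s p = 0) (hqs : Polynomial.aeval s q = 0) : p ∣ q := by
  let L := FractionRing S
  have : FaithfulSMul R L := FaithfulSMul.trans R S L
  let _ := FractionRing.liftAlgebra R L
  have hprim := hp.isPrimitive hdeg
  have hK := (hprim.irreducible_iff_irreducible_map_fraction_map (K := FractionRing R)).1 hp
  refine hprim.dvd_of_fraction_map_dvd_fraction_map (K := FractionRing R) ?_
  have h : ∀ r : R[X], Polynomial.aeval s r = 0 →
      Polynomial.aeval (algebraMap S L s) (r.map (algebraMap R (FractionRing R))) = 0 := by
    intro r hr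
    rw [Polynomial.aeval_map_algebraMap, Polynomial.aeval_algebraMap_apply, hr, map_zero]
  exact (hK.dvd_iff_aeval_eq_zero (h p hps)).1 (h q hqs)

theorem Polynomial.exists_eq_sum_X_pow_mul_expand {R : Type*} [CommRing R] {p : ℕ} (hp : p ≠ 0)
    (a : R[X]) :
    ∃ b : ℕ → R[X], a = ∑ k ∈ Finset.range p, X ^ k * expand R p (b k) := by
  induction a using Polynomial.induction_on' with
  | add a b ha hb =>
    obtain ⟨a', rfl⟩ := ha
    obtain ⟨b', rfl⟩ := hb
    exact ⟨a' + b', by simp [mul_add, Finset.sum_add_distrib]⟩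
  | monomial n c =>
    refine ⟨Pi.single (n % p) (monomial (n / p) c), ?_⟩
    rw [Finset.sum_eq_single_of_mem (n % p) (by simpa using Nat.mod_lt _ (Nat.pos_of_ne_zero hp))
      fun k _ hk => by simp [hk]]
    rw [Pi.single_eq_same, expand_monomial, X_pow_mul_monomial]
    congr 1
    rw [Nat.div_add_mod']

theorem Polynomial.exists_eq_sum_C_X_pow_mul_map_expand {R : Type*} [CommRing R] {p : ℕ}
    (hp : p ≠ 0) (Q : R[X][X]) :
    ∃ q : ℕ → R[X][X],
      Q = ∑ k ∈ Finset.range p, C (X ^ k) * (q k).map (expand R p).toRingHom := by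
  induction Q using Polynomial.induction_on' with
  | add a b ha hb =>
    obtain ⟨a', rfl⟩ := ha
    obtain ⟨b', rfl⟩ := hb
    exact ⟨a' + b', by simp [mul_add, Finset.sum_add_distrib]⟩
  | monomial n c =>
    obtain ⟨b, hb⟩ := exists_eq_sum_X_pow_mul_expand hp c
    refine ⟨fun k => monomial n (b k), ?_⟩
    conv_lhs => rw [hb]
    simp only [map_sum, map_monomial, C_mul_monomial, AlgHom.toRingHom_eq_coe, RingHom.coe_coe]

/-- The summands have exponents in distinct residue classes modulo `p`, so they cannot cancel. -/
theorem PowerSeries.eq_zero_of_sum_X_pow_mul_expand_eq_zero {R : Type*} [CommRing R] {p : ℕ}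
    (hp : p ≠ 0) (h : ℕ → R⟦X⟧)
    (hsum : ∑ k ∈ Finset.range p, X ^ k * expand p hp (h k) = 0) {k : ℕ} (hk : k < p) :
    h k = 0 := by
  ext m
  have := congrArg (coeff (p * m + k)) hsum
  rw [map_sum, Finset.sum_eq_single_of_mem k (Finset.mem_range.2 hk)] at this
  · rwa [coeff_X_pow_mul, coeff_expand_mul] at this
  · intro j hj hjk
    rw [coeff_X_pow_mul']
    split_ifs with hle
    · refine coeff_expand_of_not_dvd p hp _ fun hdvd => hjk ?_
      have h1 : p * m + k ≡ j [MOD p] := ((Nat.modEq_iff_dvd' hle).2 hdvd).symm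
      have h2 : k ≡ j [MOD p] := by simpa [Nat.ModEq] using h1
      exact (Nat.ModEq.eq_of_lt_of_lt h2 hk (Finset.mem_range.1 hj)).symm
    · rfl

theorem PowerSeries.algebraMap_expand {R : Type*} [CommRing R] {p : ℕ} (hp : p ≠ 0) (a : R[X]) :
    algebraMap R[X] R⟦X⟧ (Polynomial.expand R p a) = expand p hp (algebraMap R[X] R⟦X⟧ a) := by
  ext n
  simp [algebraMap_apply', coeff_expand, Polynomial.coeff_expand (Nat.pos_of_ne_zero hp)]

theorem PowerSeries.aeval_expand_map_expand {R : Type*} [CommRing R] {p : ℕ} (hp : p ≠ 0)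
    (f : R⟦X⟧) (Q : R[X][X]) :
    Polynomial.aeval (expand p hp f) (Q.map (Polynomial.expand R p).toRingHom) =
      expand p hp (Polynomial.aeval f Q) := by
  rw [Polynomial.aeval_def, Polynomial.aeval_def, Polynomial.eval₂_map]
  have := Polynomial.hom_eval₂ Q (algebraMap R[X] R⟦X⟧) (expand p hp).toRingHom f
  refine Eq.trans ?_ this.symm
  congr 1
  exact RingHom.ext fun a => algebraMap_expand hp a

theorem PowerSeries.faithfulSMul_polynomial : FaithfulSMul ℤ[X] ℤ⟦X⟧ := by
  rw [faithfulSMul_iff_algebraMap_injective]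
  intro a b h
  simpa [algebraMap_apply'] using h

/-- If `P` generates the equations of `f` over the polynomials then `P(x ^ p, F)` generates those
of `f(x ^ p)`. -/
theorem PowerSeries.map_expand_dvd_of_aeval_expand_eq_zero {R : Type*} [CommRing R] {p : ℕ}
    (hp : p ≠ 0) {f : R⟦X⟧} {P Q : R[X][X]}
    (hP : ∀ q : R[X][X], Polynomial.aeval f q = 0 → P ∣ q)
    (hQ : Polynomial.aeval (expand p hp f) Q = 0) :
    P.map (Polynomial.expand R p).toRingHom ∣ Q := by
  obtain ⟨q, rfl⟩ := Polynomial.exists_eq_sum_C_X_pow_mul_map_expand hp Q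
  refine Finset.dvd_sum fun k hk => Dvd.dvd.mul_left (Polynomial.map_dvd _ (hP _ ?_)) _
  refine eq_zero_of_sum_X_pow_mul_expand_eq_zero hp (fun k => Polynomial.aeval f (q k)) ?_
    (Finset.mem_range.1 hk)
  simpa only [map_sum, map_mul, aeval_expand_map_expand, Polynomial.aeval_C, algebraMap_apply',
    Polynomial.coe_pow, Polynomial.coe_X, map_pow, map_X] using hQ

theorem PowerSeries.map_algebraMap_eq_aeval {K : Type*} [Field K] (φ : ℤ⟦X⟧ →+* K) (a : ℤ[X]) :
    φ (algebraMap ℤ[X] ℤ⟦X⟧ a) = Polynomial.aeval (φ X) a := by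
  have h : φ.comp (algebraMap ℤ[X] ℤ⟦X⟧) =
      (Polynomial.aeval (R := ℤ) (φ X) : ℤ[X] →+* K) :=
    Polynomial.ringHom_ext' (Subsingleton.elim _ _) (by simp [algebraMap_apply'])
  exact RingHom.congr_fun h a

/-! ### The equation for the generating function and the conclusion. -/

theorem aeval_genFun123_eqPoly4 : Polynomial.aeval (genFun123 4) eqPoly4 = 0 := by
  let ι := algebraMap ℤ⟦X⟧ (FractionRing ℤ⟦X⟧)
  have hι : Function.Injective ι := IsFractionRing.injective _ _
  have hX : ι PowerSeries.X ≠ 0 := (map_ne_zero_iff _ hι).2 PowerSeries.X_ne_zero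
  -- The constant term is `-256`.
  have hD : (5 * ι PowerSeries.X - 256) * (4 * ι PowerSeries.X + 1) ≠ 0 := by
    have : ι ((5 * PowerSeries.X - 256) * (4 * PowerSeries.X + 1)) ≠ 0 := by
      refine (map_ne_zero_iff _ hι).2 fun h => ?_
      have := congrArg PowerSeries.constantCoeff h
      have h256 := map_ofNat (PowerSeries.constantCoeff (R := ℤ)) 256
      simp [h256] at this
    simpa only [map_mul, map_sub, map_add, map_ofNat, map_one] using this
  have : CharZero (FractionRing ℤ⟦X⟧) :=
    charZero_of_injective_algebraMap (R := ℤ) ((hι.comp (PowerSeries.C_injective)).comp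
      (fun _ _ h => h))
  have key := scheme_elimination (ι PowerSeries.X) hX hD (fun i j => ι (countSeries 4 i j))
    (fun i j => by
      rw [countSeries_succ 3]
      simp [Finset.sum_range_succ])
    (fun i => by
      rw [← map_mul, X_mul_countSeries_last 4, map_sub, map_one])
  apply hι
  rw [map_zero, ← key, eqPoly4, map_sum, map_sum, genFun123_eq]
  refine Finset.sum_congr rfl fun k _ => ?_
  simp only [map_mul, map_pow, Polynomial.aeval_C, Polynomial.aeval_X]
  congr 1
  exact PowerSeries.map_algebraMap_eq_aeval ι _

theorem eqPoly4_dvd {Q : ℤ[X][X]} (hQ : Polynomial.aeval (genFun123 4) Q = 0) : eqPoly4 ∣ Q :=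
  let _ : NormalizedGCDMonoid ℤ[X] := UniqueFactorizationMonoid.toNormalizedGCDMonoid _
  have := PowerSeries.faithfulSMul_polynomial
  irreducible_eqPoly4.dvd_of_aeval_eq_zero (by simp [natDegree_eqPoly4])
    aeval_genFun123_eqPoly4 hQ

/-- Every unknown on the right of the scheme carries a factor `x`, so the Jacobian is the identity
modulo `x` and its determinant has constant term 1, at any point `g`. -/
theorem det_jacobian_schemeEq_ne_zero (r : ℕ) [NeZero r] (g : Sym2 (Fin r) → ℤ⟦X⟧) :
    (Matrix.of fun p q : Sym2 (Fin r) =>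
      MvPolynomial.aeval g (MvPolynomial.pderiv q (schemeEq r p.inf p.sup))).det ≠ 0 := by
  intro h
  have := congrArg PowerSeries.constantCoeff h
  rw [RingHom.map_det, map_zero] at this
  refine one_ne_zero (α := ℤ) (Eq.trans ?_ this)
  rw [← Matrix.det_one (n := Sym2 (Fin r))]
  congr 1
  ext p q
  have hp : s(p.inf, p.sup) = p := by
    induction p with
    | _ a b => rcases le_total a b with h | h <;> simp [h, Sym2.eq_swap]
  have hite : MvPolynomial.pderiv q (if p.inf = 0 ∧ p.sup = 0 then (1 : SchemeRing r) else 0) = 0 := by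
    split_ifs <;> simp
  have hX : ∀ (n : ℕ) (f : SchemeRing r), PowerSeries.constantCoeff (MvPolynomial.aeval g
      (MvPolynomial.pderiv q (MvPolynomial.C (Polynomial.X ^ (n + 1)) * f))) = 0 := fun n f => by
    rw [MvPolynomial.pderiv_C_mul]
    simp [PowerSeries.algebraMap_apply']
  have hX1 : ∀ f : SchemeRing r, PowerSeries.constantCoeff (MvPolynomial.aeval g
      (MvPolynomial.pderiv q (MvPolynomial.C Polynomial.X * f))) = 0 := fun f => by
    simpa using hX 0 f
  simp only [Matrix.one_apply, RingHom.mapMatrix_apply, Matrix.map_apply, Matrix.of_apply,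
    schemeEq, hp, map_sub, map_add, hite, map_zero, hX1, map_sum, hX, Finset.sum_const_zero,
    MvPolynomial.pderiv_X, Pi.single_apply]
  split_ifs <;> simp_all

theorem mainTheorem3 :
    -- the displayed equation, of degree 16 in F with the displayed leading coefficient, holds
    eqPoly4.natDegree = 16 ∧
    eqPoly4.leadingCoeff =
      (Polynomial.X ^ 3 * (5 * Polynomial.X - 256) ^ 4 * (4 * Polynomial.X + 1) ^ 4 : ℤ[X]) ∧
    Polynomial.aeval (genFun123 4) eqPoly4 = 0 ∧
    -- it is minimal: irreducible, of least degree, and a divisor of every other equation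
    Irreducible eqPoly4 ∧
    (∀ Q : ℤ[X][X], Q ≠ 0 → Polynomial.aeval (genFun123 4) Q = 0 → 16 ≤ Q.natDegree) ∧
    (∀ Q : ℤ[X][X], Polynomial.aeval (genFun123 4) Q = 0 → eqPoly4 ∣ Q) ∧
    -- the weight enumerators satisfy the ten equations of the scheme, and g^{(0,0)}(x) = f(x^4)
    (∀ i j : Fin 4, i ≤ j → MvPolynomial.aeval (weightEnumFamily 4) (schemeEq 4 i j) = 0) ∧
    weightEnumFamily 4 s(0, 0) = PowerSeries.expand 4 (by norm_num) (genFun123 4) ∧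
    -- elimination: on the component of the scheme that contains the weight enumerators, the
    -- equations for g^{(0,0)} alone are the multiples of P(x^4, F)
    (∀ Q : ℤ[X][X],
      (∃ h : SchemeRing 4, MvPolynomial.aeval (weightEnumFamily 4) h ≠ 0 ∧
        h * Polynomial.aeval (MvPolynomial.X s(0, 0) : SchemeRing 4) Q ∈ schemeIdeal 4) ↔
      eqPoly4.map (Polynomial.expand ℤ 4 : ℤ[X] →ₐ[ℤ] ℤ[X]).toRingHom ∣ Q) := by
  refine ⟨natDegree_eqPoly4, leadingCoeff_eqPoly4, aeval_genFun123_eqPoly4, irreducible_eqPoly4,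
    fun Q h0 hQ => ?_, fun Q hQ => eqPoly4_dvd hQ, aeval_schemeEq, weightEnumFamily_zero,
    fun Q => ?_⟩
  · rw [← natDegree_eqPoly4]
    exact Polynomial.natDegree_le_of_dvd (eqPoly4_dvd hQ) h0
  have hev : ∀ Q : ℤ[X][X], MvPolynomial.aeval (weightEnumFamily 4)
      (Polynomial.aeval (MvPolynomial.X s(0, 0) : SchemeRing 4) Q) =
        Polynomial.aeval (PowerSeries.expand 4 (by norm_num) (genFun123 4)) Q := fun Q => by
    rw [← weightEnumFamily_zero, ← Polynomial.aeval_algHom_apply, MvPolynomial.aeval_X]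
  constructor
  -- Evaluating at the weight enumerators kills the ideal but not `h`, so `Q` vanishes at `f(x^4)`.
  · rintro ⟨h, hh, hmem⟩
    refine PowerSeries.map_expand_dvd_of_aeval_expand_eq_zero (by norm_num)
      (fun q hq => eqPoly4_dvd hq) ?_
    have hle : schemeIdeal 4 ≤ RingHom.ker (MvPolynomial.aeval (R := ℤ[X]) (weightEnumFamily 4)) := by
      rw [schemeIdeal, Ideal.span_le]
      rintro _ ⟨i, j, hij, rfl⟩
      exact aeval_schemeEq i j hij
    have := hle hmem
    rw [RingHom.mem_ker, map_mul, hev] at this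
    exact (mul_eq_zero.1 this).resolve_left hh
  -- It suffices to treat `P(x^4, F)` itself: the `h` given by the Jacobian criterion also serves
  -- for its multiples.
  · rintro ⟨R, rfl⟩
    have := PowerSeries.faithfulSMul_polynomial
    obtain ⟨h, hh, hmem⟩ := MvPolynomial.exists_mul_mem_span_of_jacobian (weightEnumFamily 4)
      (fun p => schemeEq 4 p.inf p.sup) (fun p => aeval_schemeEq _ _ p.inf_le_sup)
      (det_jacobian_schemeEq_ne_zero 4 _)
      (q := Polynomial.aeval (MvPolynomial.X s(0, 0) : SchemeRing 4)
        (eqPoly4.map (Polynomial.expand ℤ 4 : ℤ[X] →ₐ[ℤ] ℤ[X]).toRingHom)) (by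
          rw [hev, PowerSeries.aeval_expand_map_expand, aeval_genFun123_eqPoly4, map_zero])
    refine ⟨h, hh, ?_⟩
    rw [map_mul, ← mul_assoc]
    refine Ideal.mul_mem_right _ _ (Ideal.span_mono ?_ hmem)
    rintro _ ⟨p, rfl⟩
    exact ⟨_, _, p.inf_le_sup, rfl⟩
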